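/- Let $\mathbb H^1$ be the first Heisenberg group, that is, $\mathbb R^3$ with coordinates $(x,y,t)$ and the group law $(x,y,t)\circ(x',y',t')=\bigl(x+x',\,y+y',\,t+t'+\tfrac12(xy'-x'y)\bigr)$, with the left-invariant vector fields $X_1=\partial_x-\tfrac y2\partial_t$, $X_2=\partial_y+\tfrac x2\partial_t$, $T=\partial_t$ and with the Riemannian metric for which $X_1,X_2,T$ are orthonormal. For an embedded $C^2$ surface $S\subset\mathbb H^1$ without boundary, locally the zero set of a $C^2$ function $f$ with $df\neq0$, put $p=X_1f$, $q=X_2f$, $W=\sqrt{p^2+q^2}$. The characteristic locus of $S$ is the set of points of $S$ with $W=0$, and $S$ is called minimal if its horizontal mean curvature $X_1(p/W)+X_2(q/W)$ vanishes at all points of $S$ outside the characteristic locus. A vertical plane is a set $\{(x,y,t)\mid ax+by=\gamma\}$ with $a,b,\gamma\in\mathbb R$, $(a,b)\neq(0,0)$. A $C^2$ surface $S_0\subset\mathbb H^1$ is a strict intrinsic graphical strip if there are $\varepsilon>0$ and, with $J=(-4\varepsilon,4\varepsilon)$, functions $F,G,\sigma\in C^2(J)$ such that $F'(s)^2<2\sigma'(s)G'(s)$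 for every $s\in J$, the map $$\Psi:\mathbb R\times J\to\mathbb R^2,\qquad \Psi(u,s)=\Bigl(u,\ G(s)\tfrac{u^2}{2}+F(s)u+\sigma(s)\Bigr)$$ is one-to-one (hence a diffeomorphism onto its image $\Omega=\Psi(\mathbb R\times J)$), and $$S_0=\{(0,u,v)\circ(\phi(u,v),0,0)\mid (u,v)\in\Omega\}=\{(\phi(u,v),u,v-\tfrac u2\phi(u,v))\mid(u,v)\in\Omega\},$$ where $\phi\in C^2(\Omega)$ is the function given by $\phi(\Psi(u,s))=F(s)+u\,G(s)$ for $(u,s)\in\mathbb R\times J$. Theorem. Let $S\subset\mathbb H^1$ be a connected, noncompact, embedded $C^2$ minimal surface without boundary, complete for the distance of the induced Riemannian metric, with empty characteristic locus. If $S$ is not a vertical plane, then $S$ contains a strict intrinsic graphical strip. -/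

import Mathlib

namespace Heisenberg

/-- The underlying manifold `ℝ³` of the first Heisenberg group, with coordinates `(x, y, t)`. -/
abbrev Heis : Type := ℝ × ℝ × ℝ

/-- The group law `g ∘ g' = (x + x', y + y', t + t' + (x y' - x' y) / 2)`. -/
noncomputable def mul (g h : Heis) : Heis :=
  (g.1 + h.1, g.2.1 + h.2.1, g.2.2 + h.2.2 + (g.1 * h.2.1 - h.1 * g.2.1) / 2)

/-- The left-invariant vector field `X₁ = ∂ₓ - (y / 2) ∂ₜ`. -/
noncomputable def X1 (g : Heis) : Heis := (1, 0, -g.2.1 / 2)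

/-- The left-invariant vector field `X₂ = ∂_y + (x / 2) ∂ₜ`. -/
noncomputable def X2 (g : Heis) : Heis := (0, 1, g.1 / 2)

/-- The left-invariant vector field `T = ∂ₜ`. -/
def T (_g : Heis) : Heis := (0, 0, 1)

/-- The `T`-component, in the frame `X₁, X₂, T`, of a tangent vector `w` at `g`. -/
noncomputable def tComp (g w : Heis) : ℝ := w.2.2 - (g.1 * w.2.1 - g.2.1 * w.1) / 2

/-- The components of a tangent vector `w` at `g` in the frame `X₁, X₂, T`
are `w.1`, `w.2.1` and `tComp g w`. -/
theorem frame_decomposition (g w : Heis) :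
    w = w.1 • X1 g + w.2.1 • X2 g + tComp g w • T g := by
  ext <;> simp [X1, X2, T, tComp]
  ring

/-- The norm of a tangent vector `w` at `g` for the left-invariant Riemannian metric
for which `X₁, X₂, T` are orthonormal. -/
noncomputable def riemNorm (g w : Heis) : ℝ :=
  Real.sqrt (w.1 ^ 2 + w.2.1 ^ 2 + tComp g w ^ 2)

/-- The Riemannian length of a curve parametrized by `[0, 1]`. -/
noncomputable def curveLength (c : ℝ → Heis) : ℝ :=
  ∫ τ in (0 : ℝ)..1, riemNorm (c τ) (deriv c τ)

/-- `c` restricts to a `C¹` curve in `S`, parametrized by `[0, 1]`, from `p` to `q`.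
(Every `C¹` curve on `[0, 1]` is the restriction of a `C¹` map on `ℝ`, and only `[0, 1]` is
required to go into `S`.  The velocity may vanish, so piecewise `C¹` curves are covered up to
reparametrization.) -/
def IsCurveIn (S : Set Heis) (p q : Heis) (c : ℝ → Heis) : Prop :=
  ContDiff ℝ 1 c ∧ (∀ τ ∈ Set.Icc (0 : ℝ) 1, c τ ∈ S) ∧ c 0 = p ∧ c 1 = q

/-- The distance on `S` of the induced Riemannian metric: the infimum of the lengths of the
curves in `S` from `p` to `q` (it is `∞` if there is none). -/
noncomputable def intrinsicDist (S : Set Heis) (p q : Heis) : ENNReal :=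
  ⨅ (c : ℝ → Heis) (_ : IsCurveIn S p q c), ENNReal.ofReal (curveLength c)

/-- `S` is complete for the distance of the induced Riemannian metric:
each Cauchy sequence converges to a point of `S`. -/
def IsCompleteSurface (S : Set Heis) : Prop :=
  ∀ a : ℕ → Heis, (∀ n, a n ∈ S) →
    (∀ δ : ENNReal, 0 < δ → ∃ N, ∀ m ≥ N, ∀ n ≥ N, intrinsicDist S (a m) (a n) < δ) →
    ∃ p ∈ S, ∀ δ : ENNReal, 0 < δ → ∃ N, ∀ n ≥ N, intrinsicDist S (a n) p < δ

/-- `f` is a `C²` defining function of `S` on the open set `U`, with nowhere vanishing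
differential. -/
structure IsDefiningFunction (S U : Set Heis) (f : Heis → ℝ) : Prop where
  isOpen : IsOpen U
  contDiffOn : ContDiffOn ℝ 2 f U
  fderiv_ne_zero : ∀ g ∈ U, fderiv ℝ f g ≠ 0
  inter_eq : S ∩ U = {g | f g = 0} ∩ U

/-- `S` is an embedded `C²` surface without boundary (a two-dimensional embedded `C²`
submanifold of `ℝ³`). -/
def IsC2Surface (S : Set Heis) : Prop :=
  ∀ g ∈ S, ∃ (U : Set Heis) (f : Heis → ℝ), g ∈ U ∧ IsDefiningFunction S U f

/-- `X₁ f` -/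
noncomputable def dX1 (f : Heis → ℝ) (g : Heis) : ℝ := fderiv ℝ f g (X1 g)

/-- `X₂ f` -/
noncomputable def dX2 (f : Heis → ℝ) (g : Heis) : ℝ := fderiv ℝ f g (X2 g)

/-- The length `W = √(p² + q²)` of the horizontal normal `p X₁ + q X₂`, `p = X₁ f`, `q = X₂ f`,
which belongs to the Riemannian normal `N = (X₁ f) X₁ + (X₂ f) X₂ + (T f) T`. -/
noncomputable def W (f : Heis → ℝ) (g : Heis) : ℝ := Real.sqrt (dX1 f g ^ 2 + dX2 f g ^ 2)

/-- The characteristic locus of `S`: the points at which the horizontal part of the normal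
vanishes, that is, the tangent plane is spanned by `X₁` and `X₂`. -/
def charLocus (S : Set Heis) : Set Heis :=
  {g | g ∈ S ∧ ∃ (U : Set Heis) (f : Heis → ℝ), g ∈ U ∧ IsDefiningFunction S U f ∧ W f g = 0}

/-- The horizontal mean curvature `X₁ (p / W) + X₂ (q / W)` at `g`, for the normal given by
the defining function `f`. -/
noncomputable def hMeanCurvature (f : Heis → ℝ) (g : Heis) : ℝ :=
  dX1 (fun h => dX1 f h / W f h) g + dX2 (fun h => dX2 f h / W f h) g

/-- The horizontal mean curvature of `S` vanishes outside the characteristic locus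
(there it does not depend, up to sign, on the defining function). -/
def IsHMinimal (S : Set Heis) : Prop :=
  ∀ g ∈ S \ charLocus S, ∀ (U : Set Heis) (f : Heis → ℝ), g ∈ U → IsDefiningFunction S U f →
    hMeanCurvature f g = 0

/-- A vertical plane `a x + b y = γ`, `(a, b) ≠ (0, 0)`. -/
def IsVerticalPlane (S : Set Heis) : Prop :=
  ∃ a b γ : ℝ, (a ≠ 0 ∨ b ≠ 0) ∧ S = {g : Heis | a * g.1 + b * g.2.1 = γ}

/-- The map `Ψ (u, s) = (u, G(s) u² / 2 + F(s) u + σ(s))`. -/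
noncomputable def Psi (F G σ : ℝ → ℝ) (w : ℝ × ℝ) : ℝ × ℝ :=
  (w.1, G w.2 * (w.1 ^ 2 / 2) + F w.2 * w.1 + σ w.2)

/-- `S` is a strict intrinsic graphical strip on `J = (-4ε, 4ε)`.  Since `Ψ` is one-to-one,
the condition `φ (Ψ (u, s)) = F s + u * G s` says
`φ (u, v) = F (s (u, v)) + u * G (s (u, v))` on `Ω = Ψ (ℝ × J)`. -/
def IsStrictIntrinsicGraphicalStrip (ε : ℝ) (S : Set Heis) : Prop :=
  0 < ε ∧ IsC2Surface S ∧
  ∃ F G σ : ℝ → ℝ,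
    ContDiffOn ℝ 2 F (Set.Ioo (-(4 * ε)) (4 * ε)) ∧
    ContDiffOn ℝ 2 G (Set.Ioo (-(4 * ε)) (4 * ε)) ∧
    ContDiffOn ℝ 2 σ (Set.Ioo (-(4 * ε)) (4 * ε)) ∧
    (∀ s ∈ Set.Ioo (-(4 * ε)) (4 * ε), deriv F s ^ 2 < 2 * deriv σ s * deriv G s) ∧
    Set.InjOn (Psi F G σ) (Set.univ ×ˢ Set.Ioo (-(4 * ε)) (4 * ε)) ∧
    ∃ (Ω : Set (ℝ × ℝ)) (φ : ℝ × ℝ → ℝ),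
      Ω = Psi F G σ '' (Set.univ ×ˢ Set.Ioo (-(4 * ε)) (4 * ε)) ∧
      ContDiffOn ℝ 2 φ Ω ∧
      (∀ u : ℝ, ∀ s ∈ Set.Ioo (-(4 * ε)) (4 * ε), φ (Psi F G σ (u, s)) = F s + u * G s) ∧
      S = (fun w : ℝ × ℝ => mul (0, w.1, w.2) (φ w, 0, 0)) '' Ω

end Heisenberg

/-! Let `n = (p/W, q/W)` be the horizontal unit normal and `Z = -(q/W) X₁ + (p/W) X₂` the horizontal
unit tangent. Since `|n| = 1`, minimality forces `Z n = 0` (`fderiv_normal_unitTangent`). Hence the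
integral curves of `Z` in `S` are pieces of horizontal lines (`eventually_line_mem`), and
completeness puts the whole lines into `S` (`line_mem`).

In the coordinates `(x, u, v) = (x, y, t + xy/2)` a horizontal line not parallel to `X₁` is `u ↦ (F
+ G u, u, s + F u + G u²/2)`. Near such a line, those in `S` form a family with `F`, `G` of class
`C²` in `s` (`IsRuled.exists_family`). Put `J = ∂v/∂s = 1 + F' u + G' u²/2`. A zero of `J` would be
a double zero, and tangency of `∂/∂s` would then make `∂ₓ` tangent to `S` there, so that the point
would be characteristic (`IsRuled.jacobian_ne_zero`). As the lines are complete, the quadratic `J`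
has no real zero at all: either `F' = G' = 0` or `F'² < 2 G'` (`quadratic_dichotomy`).

The second alternative at a single `s` yields a strict strip (`exists_strip`). If only the first
occurs, neighbouring lines have one slope and lie in one vertical plane, and connectedness and
completeness identify `S` with that plane (`IsRuled.eq_plane_of_isSlope`). If instead all the lines
are parallel to `X₁`, then `∂ᵥ` must be tangent as well, since otherwise some point of a line would
be characteristic; so `S` is a plane `y = const` (`IsRuled.eq_plane_of_not_isSlope`). -/

open Set Filter Topology

namespace Heisenberg

/-! ### Local equations and horizontal lines -/

/-- `h` is a `C²` local equation of the set `M` near `P`. -/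
def IsChart (M : Set Heis) (h : Heis → ℝ) (P : Heis) : Prop :=
  ContDiffAt ℝ 2 h P ∧ ∀ᶠ z in 𝓝 P, (z ∈ M ↔ h z = 0)

theorem IsChart.fderiv_apply_eq_zero {M : Set Heis} {h : Heis → ℝ} {c : ℝ → Heis} {w : Heis}
    {r : ℝ} (hh : IsChart M h (c r)) (hc : HasDerivAt c w r)
    (hM : ∃ᶠ τ in 𝓝[≠] r, c τ ∈ M) : fderiv ℝ h (c r) w = 0 := by
  by_contra hne
  have hd : HasDerivAt (h ∘ c) (fderiv ℝ h (c r) w) r :=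
    (hh.1.differentiableAt (by simp)).hasFDerivAt.comp_hasDerivAt r hc
  have h1 := hd.eventually_ne hne (c := 0)
  have h2 : ∀ᶠ τ in 𝓝[≠] r, (c τ ∈ M ↔ h (c τ) = 0) :=
    (hc.continuousAt.eventually hh.2).filter_mono nhdsWithin_le_nhds
  obtain ⟨τ, ha, hb, hd⟩ := (hM.and_eventually (h1.and h2)).exists
  exact hb (hd.1 ha)

theorem IsDefiningFunction.isChart {S U : Set Heis} {f : Heis → ℝ}
    (hf : IsDefiningFunction S U f) {g : Heis} (hg : g ∈ U) : IsChart S f g := by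
  refine ⟨hf.contDiffOn.contDiffAt (hf.isOpen.mem_nhds hg), ?_⟩
  filter_upwards [hf.isOpen.mem_nhds hg] with z hz
  have := Set.ext_iff.1 hf.inter_eq z
  simpa [hz] using this

theorem hasDerivAt_coords {c : ℝ → Heis} {w : Heis} {r : ℝ} (hc : HasDerivAt c w r) :
    HasDerivAt (fun τ => (c τ).1) w.1 r ∧ HasDerivAt (fun τ => (c τ).2.1) w.2.1 r ∧
      HasDerivAt (fun τ => (c τ).2.2) w.2.2 r := by
  have h2 : HasDerivAt (fun τ => (c τ).2) w.2 r :=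
    (ContinuousLinearMap.snd ℝ ℝ (ℝ × ℝ)).hasFDerivAt.comp_hasDerivAt r hc
  exact ⟨(ContinuousLinearMap.fst ℝ ℝ (ℝ × ℝ)).hasFDerivAt.comp_hasDerivAt r hc,
    (ContinuousLinearMap.fst ℝ ℝ ℝ).hasFDerivAt.comp_hasDerivAt r h2,
    (ContinuousLinearMap.snd ℝ ℝ ℝ).hasFDerivAt.comp_hasDerivAt r h2⟩

/-- The horizontal line through `g` with direction `a X₁ + b X₂`. -/
noncomputable def line (g : Heis) (a b τ : ℝ) : Heis :=
  (g.1 + a * τ, g.2.1 + b * τ, g.2.2 + (g.1 * b - g.2.1 * a) / 2 * τ)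

@[simp] theorem line_zero (g : Heis) (a b : ℝ) : line g a b 0 = g := by simp [line]

theorem line_mul (g : Heis) (l a b τ : ℝ) : line g (l * a) (l * b) τ = line g a b (l * τ) := by
  ext <;> simp [line] <;> ring

theorem line_line (g : Heis) (a b τ ρ : ℝ) :
    line (line g a b τ) a b ρ = line g a b (τ + ρ) := by
  ext <;> simp [line] <;> ring

theorem contDiff_line (g : Heis) (a b : ℝ) : ContDiff ℝ 1 (line g a b) := by
  unfold line; fun_prop

theorem hasDerivAt_line (g : Heis) (a b τ : ℝ) :
    HasDerivAt (line g a b) (a • X1 (line g a b τ) + b • X2 (line g a b τ)) τ := by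
  have h1 (k l : ℝ) : HasDerivAt (fun τ : ℝ => k + l * τ) l τ := by
    simpa using ((hasDerivAt_id τ).const_mul l).const_add k
  convert! (h1 g.1 a).prodMk ((h1 g.2.1 b).prodMk (h1 g.2.2 ((g.1 * b - g.2.1 * a) / 2))) using 1
  ext <;> simp [line, X1, X2]
  ring

theorem eqOn_Ioo_of_deriv_eq_zero {E : Type*} [NormedAddCommGroup E] [NormedSpace ℝ E]
    {k : ℝ → E} {δ : ℝ} (hk : ∀ τ ∈ Ioo (-δ) δ, HasDerivAt k 0 τ) :
    ∀ τ ∈ Ioo (-δ) δ, k τ = k 0 := by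
  intro τ hτ
  have h0 : (0 : ℝ) ∈ Ioo (-δ) δ := by constructor <;> linarith [hτ.1, hτ.2]
  exact isOpen_Ioo.is_const_of_deriv_eq_zero isPreconnected_Ioo
    (fun t ht => (hk t ht).differentiableAt.differentiableWithinAt) (fun t ht => (hk t ht).deriv)
    hτ h0

/-! ### The horizontal normal and the local ruling by lines -/

theorem contDiffAt_dX1 {f : Heis → ℝ} {z : Heis} (hf : ContDiffAt ℝ 2 f z) :
    ContDiffAt ℝ 1 (dX1 f) z := by
  have h1 : ContDiffAt ℝ 1 X1 z := by unfold X1; fun_prop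
  exact (hf.fderiv_right (m := 1) (by norm_num)).clm_apply h1

theorem contDiffAt_dX2 {f : Heis → ℝ} {z : Heis} (hf : ContDiffAt ℝ 2 f z) :
    ContDiffAt ℝ 1 (dX2 f) z := by
  have h1 : ContDiffAt ℝ 1 X2 z := by unfold X2; fun_prop
  exact (hf.fderiv_right (m := 1) (by norm_num)).clm_apply h1

theorem sq_add_sq_pos_of_W_ne {f : Heis → ℝ} {z : Heis} (hW : W f z ≠ 0) :
    0 < dX1 f z ^ 2 + dX2 f z ^ 2 := by
  by_contra hn
  exact hW (Real.sqrt_eq_zero_of_nonpos (not_lt.1 hn))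

theorem contDiffAt_W {f : Heis → ℝ} {z : Heis} (hf : ContDiffAt ℝ 2 f z) (hW : W f z ≠ 0) :
    ContDiffAt ℝ 1 (W f) z :=
  (((contDiffAt_dX1 hf).pow 2).add ((contDiffAt_dX2 hf).pow 2)).sqrt
    (sq_add_sq_pos_of_W_ne hW).ne'

theorem sq_div_W_add_sq_div_W {f : Heis → ℝ} {z : Heis} (hW : W f z ≠ 0) :
    (dX1 f z / W f z) ^ 2 + (dX2 f z / W f z) ^ 2 = 1 := by
  have : W f z ^ 2 = dX1 f z ^ 2 + dX2 f z ^ 2 := Real.sq_sqrt (by positivity)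
  field_simp
  exact this.symm

/-- The horizontal unit tangent field of the level sets of `f`. -/
noncomputable def unitTangent (f : Heis → ℝ) (z : Heis) : Heis :=
  (-(dX2 f z / W f z)) • X1 z + (dX1 f z / W f z) • X2 z

theorem contDiffAt_unitTangent {f : Heis → ℝ} {z : Heis} (hf : ContDiffAt ℝ 2 f z)
    (hW : W f z ≠ 0) : ContDiffAt ℝ 1 (unitTangent f) z := by
  have h1 : ContDiffAt ℝ 1 X1 z := by unfold X1; fun_prop
  have h2 : ContDiffAt ℝ 1 X2 z := by unfold X2; fun_prop
  exact (((contDiffAt_dX2 hf).div (contDiffAt_W hf hW) hW).neg.smul h1).add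
    (((contDiffAt_dX1 hf).div (contDiffAt_W hf hW) hW).smul h2)

theorem fderiv_apply_unitTangent (f : Heis → ℝ) (z : Heis) :
    fderiv ℝ f z (unitTangent f z) = 0 := by
  have h1 : fderiv ℝ f z (X1 z) = dX1 f z := rfl
  have h2 : fderiv ℝ f z (X2 z) = dX2 f z := rfl
  simp only [unitTangent, map_add, map_smul, h1, h2, smul_eq_mul]
  ring

/-- Along the unit tangent, the unit normal is constant at points of vanishing horizontal mean
curvature. -/
theorem fderiv_normal_unitTangent {f : Heis → ℝ} {z : Heis} (hf : ContDiffAt ℝ 2 f z)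
    (hW : W f z ≠ 0) (hH : hMeanCurvature f z = 0) :
    fderiv ℝ (fun y => dX1 f y / W f y) z (unitTangent f z) = 0 ∧
      fderiv ℝ (fun y => dX2 f y / W f y) z (unitTangent f z) = 0 := by
  set n₁ : Heis → ℝ := fun y => dX1 f y / W f y with hn₁
  set n₂ : Heis → ℝ := fun y => dX2 f y / W f y with hn₂
  have hd₁ : DifferentiableAt ℝ n₁ z :=
    ((contDiffAt_dX1 hf).div (contDiffAt_W hf hW) hW).differentiableAt (by simp)
  have hd₂ : DifferentiableAt ℝ n₂ z :=
    ((contDiffAt_dX2 hf).div (contDiffAt_W hf hW) hW).differentiableAt (by simp)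
  have hone : (fun y => n₁ y * n₁ y + n₂ y * n₂ y) =ᶠ[𝓝 z] fun _ => 1 := by
    filter_upwards [(contDiffAt_W hf hW).continuousAt.eventually_ne hW] with y hy
    simpa [pow_two] using sq_div_W_add_sq_div_W hy
  have hderiv := hone.fderiv_eq (𝕜 := ℝ)
  have hfd : fderiv ℝ (fun y => n₁ y * n₁ y + n₂ y * n₂ y) z =
      (n₁ z • fderiv ℝ n₁ z + n₁ z • fderiv ℝ n₁ z) +
      (n₂ z • fderiv ℝ n₂ z + n₂ z • fderiv ℝ n₂ z) :=
    ((hd₁.hasFDerivAt.fun_mul hd₁.hasFDerivAt).fun_add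
      (hd₂.hasFDerivAt.fun_mul hd₂.hasFDerivAt)).fderiv
  have key (w : Heis) : n₁ z * fderiv ℝ n₁ z w + n₂ z * fderiv ℝ n₂ z w = 0 := by
    have := DFunLike.congr_fun (hfd.symm.trans hderiv) w
    simp at this
    linarith
  have hH' : fderiv ℝ n₁ z (X1 z) + fderiv ℝ n₂ z (X2 z) = 0 := hH
  have hu : unitTangent f z = (-(n₂ z)) • X1 z + n₁ z • X2 z := rfl
  rw [hu]
  simp only [map_add, map_smul, smul_eq_mul]
  constructor
  -- Minimality replaces `X₁ n₁` by `-X₂ n₂`, which turns `Z n₁` into `⟨n, X₂ n⟩ = 0`; likewise `Z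
  -- n₂` becomes `-⟨n, X₁ n⟩`.
  · linear_combination key (X2 z) - n₂ z * hH'
  · linear_combination -key (X1 z) + n₁ z * hH'

/-- An integral curve of the unit tangent stays in `S` because `f` is constant along it. The normal
is constant along it too, so its velocity has constant coefficients in `X₁`, `X₂`: it is a
horizontal line. -/
theorem eventually_line_mem {S U : Set Heis} {f : Heis → ℝ} (hf : IsDefiningFunction S U f)
    (hchar : charLocus S = ∅) (hmin : IsHMinimal S) {g : Heis} (hgS : g ∈ S) (hgU : g ∈ U)
    {a b : ℝ} (hab : a * dX1 f g + b * dX2 f g = 0) :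
    ∀ᶠ τ in 𝓝 (0 : ℝ), line g a b τ ∈ S := by
  have hC2 : ∀ z ∈ U, ContDiffAt ℝ 2 f z := fun z hz => (hf.isChart hz).1
  have hWg : W f g ≠ 0 := by
    intro h0
    have : g ∈ charLocus S := ⟨hgS, U, f, hgU, hf, h0⟩
    simp [hchar] at this
  obtain ⟨γ, hγ0, ε, hε, hγ⟩ :=
    (contDiffAt_unitTangent (hC2 g hgU) hWg).exists_forall_mem_closedBall_exists_eq_forall_mem_Ioo_hasDerivAt₀ 0
  have hcont : ContinuousAt γ 0 := (hγ 0 (by constructor <;> linarith)).continuousAt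
  have hV : ∀ᶠ z in 𝓝 (γ 0), z ∈ U ∧ W f z ≠ 0 := by
    rw [hγ0]
    exact (hf.isOpen.eventually_mem hgU).and
      ((contDiffAt_W (hC2 g hgU) hWg).continuousAt.eventually_ne hWg)
  obtain ⟨δ, hδ, hball⟩ := Metric.eventually_nhds_iff.1
    ((hcont.eventually hV).and (Ioo_mem_nhds (show 0 - ε < 0 by linarith) (show 0 < 0 + ε by linarith)))
  have hI : ∀ τ ∈ Ioo (-δ) δ, (γ τ ∈ U ∧ W f (γ τ) ≠ 0) ∧
      HasDerivAt γ (unitTangent f (γ τ)) τ := by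
    intro τ hτ
    have := hball (y := τ) (by rw [Real.dist_eq, sub_zero, abs_lt]; exact hτ)
    exact ⟨this.1, hγ τ this.2⟩
  have hmemS : ∀ τ ∈ Ioo (-δ) δ, γ τ ∈ S := by
    have h1 := eqOn_Ioo_of_deriv_eq_zero (k := f ∘ γ) (δ := δ) fun τ hτ => by
      have := ((hC2 _ (hI τ hτ).1.1).differentiableAt (by simp)).hasFDerivAt.comp_hasDerivAt τ
        (hI τ hτ).2
      rwa [fderiv_apply_unitTangent] at this
    intro τ hτ
    have h2 := (hf.isChart (hI τ hτ).1.1).2.self_of_nhds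
    rw [h2]
    have h3 := h1 τ hτ
    simp only [Function.comp_apply, hγ0] at h3
    rw [h3]
    exact (hf.isChart hgU).2.self_of_nhds.1 hgS
  have hHzero : ∀ τ ∈ Ioo (-δ) δ, hMeanCurvature f (γ τ) = 0 := fun τ hτ =>
    hmin _ ⟨hmemS τ hτ, by simp [hchar]⟩ U f (hI τ hτ).1.1 hf
  have hn₁ := eqOn_Ioo_of_deriv_eq_zero (k := (fun y => dX1 f y / W f y) ∘ γ) (δ := δ)
    fun τ hτ => by
      obtain ⟨⟨hU, hW⟩, hd⟩ := hI τ hτ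
      have hdiff : DifferentiableAt ℝ (fun y => dX1 f y / W f y) (γ τ) :=
        (((contDiffAt_dX1 (hC2 _ hU)).div (contDiffAt_W (hC2 _ hU) hW)
        hW).differentiableAt (by simp))
      have := hdiff.hasFDerivAt.comp_hasDerivAt τ hd
      rwa [(fderiv_normal_unitTangent (hC2 _ hU) hW (hHzero τ hτ)).1] at this
  have hn₂ := eqOn_Ioo_of_deriv_eq_zero (k := (fun y => dX2 f y / W f y) ∘ γ) (δ := δ)
    fun τ hτ => by
      obtain ⟨⟨hU, hW⟩, hd⟩ := hI τ hτ
      have hdiff : DifferentiableAt ℝ (fun y => dX2 f y / W f y) (γ τ) :=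
        (((contDiffAt_dX2 (hC2 _ hU)).div (contDiffAt_W (hC2 _ hU) hW)
        hW).differentiableAt (by simp))
      have := hdiff.hasFDerivAt.comp_hasDerivAt τ hd
      rwa [(fderiv_normal_unitTangent (hC2 _ hU) hW (hHzero τ hτ)).2] at this
  simp only [Function.comp_apply, hγ0] at hn₁ hn₂
  have hone := sq_div_W_add_sq_div_W hWg
  have hpa : dX1 f g = dX1 f g / W f g * W f g := by field_simp
  have hqb : dX2 f g = dX2 f g / W f g * W f g := by field_simp
  set α := dX1 f g / W f g
  set β := dX2 f g / W f g
  have hder : ∀ τ ∈ Ioo (-δ) δ, HasDerivAt γ ((-β) • X1 (γ τ) + α • X2 (γ τ)) τ := by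
    intro τ hτ
    have := (hI τ hτ).2
    rwa [unitTangent, hn₁ τ hτ, hn₂ τ hτ] at this
  have hx := eqOn_Ioo_of_deriv_eq_zero (k := fun τ => (γ τ).1 - (line g (-β) α τ).1) (δ := δ)
    fun τ hτ => by
      simpa [X1, X2] using (hasDerivAt_coords (hder τ hτ)).1.fun_sub (hasDerivAt_coords (hasDerivAt_line g (-β) α τ)).1
  have hy := eqOn_Ioo_of_deriv_eq_zero (k := fun τ => (γ τ).2.1 - (line g (-β) α τ).2.1) (δ := δ)
    fun τ hτ => by
      simpa [X1, X2] using (hasDerivAt_coords (hder τ hτ)).2.1.fun_sub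
        (hasDerivAt_coords (hasDerivAt_line g (-β) α τ)).2.1
  simp only [hγ0, line_zero, sub_self, sub_eq_zero] at hx hy
  -- The `t`-velocity depends on `x` and `y`, so this comparison needs the two preceding ones.
  have ht := eqOn_Ioo_of_deriv_eq_zero (k := fun τ => (γ τ).2.2 - (line g (-β) α τ).2.2) (δ := δ)
    fun τ hτ => by
      simpa [X1, X2, hx τ hτ, hy τ hτ] using
        (hasDerivAt_coords (hder τ hτ)).2.2.fun_sub
          (hasDerivAt_coords (hasDerivAt_line g (-β) α τ)).2.2
  simp only [hγ0, line_zero, sub_self, sub_eq_zero] at ht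
  have hline : ∀ τ ∈ Ioo (-δ) δ, line g (-β) α τ ∈ S := by
    intro τ hτ
    have : line g (-β) α τ = γ τ := by
      ext
      exacts [(hx τ hτ).symm, (hy τ hτ).symm, (ht τ hτ).symm]
    rw [this]
    exact hmemS τ hτ
  have hαβ : a * α + b * β = 0 := by
    rw [hpa, hqb] at hab
    have : (a * α + b * β) * W f g = 0 := by linear_combination hab
    exact (mul_eq_zero.1 this).resolve_right hWg
  -- `(a, b)` is orthogonal to the unit vector `(α, β)`, hence a multiple of `(-β, α)`.
  have ha : a = (b * α - a * β) * (-β) := by linear_combination α * hαβ - a * hone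
  have hb : b = (b * α - a * β) * α := by linear_combination β * hαβ - b * hone
  have hlim : Tendsto (fun τ : ℝ => (b * α - a * β) * τ) (𝓝 0) (𝓝 0) := by
    have : Continuous (fun τ : ℝ => (b * α - a * β) * τ) := by fun_prop
    simpa using this.tendsto 0
  filter_upwards [hlim (Ioo_mem_nhds (show -δ < 0 by linarith) hδ)] with τ hτ
  have := line_mul g (b * α - a * β) (-β) α τ
  rw [← ha, ← hb] at this
  rw [this]
  exact hline _ hτ

/-! ### Completeness and the extension of the lines -/

/-- A `C¹` curve that stays in `M` on `[0, 1)` ends in `M`. -/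
def HasEndpoints (M : Set Heis) : Prop :=
  ∀ c : ℝ → Heis, ContDiff ℝ 1 c → (∀ τ ∈ Ico (0 : ℝ) 1, c τ ∈ M) → c 1 ∈ M

theorem riemNorm_nonneg (g w : Heis) : 0 ≤ riemNorm g w := Real.sqrt_nonneg _

theorem riemNorm_smul (g w : Heis) (k : ℝ) : riemNorm g (k • w) = |k| * riemNorm g w := by
  unfold riemNorm
  rw [← Real.sqrt_sq_eq_abs, ← Real.sqrt_mul (sq_nonneg k)]
  congr 1
  simp [tComp]
  ring

theorem abs_fst_le_riemNorm (g w : Heis) : |w.1| ≤ riemNorm g w :=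
  Real.abs_le_sqrt (by nlinarith [sq_nonneg w.2.1, sq_nonneg (tComp g w)])

theorem abs_snd_le_riemNorm (g w : Heis) : |w.2.1| ≤ riemNorm g w :=
  Real.abs_le_sqrt (by nlinarith [sq_nonneg w.1, sq_nonneg (tComp g w)])

theorem abs_tComp_le_riemNorm (g w : Heis) : |tComp g w| ≤ riemNorm g w :=
  Real.abs_le_sqrt (by nlinarith [sq_nonneg w.1, sq_nonneg w.2.1])

theorem continuous_riemNorm_deriv {c : ℝ → Heis} (hc : ContDiff ℝ 1 c) :
    Continuous fun τ => riemNorm (c τ) (deriv c τ) := by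
  have h1 := hc.continuous
  have h2 := hc.continuous_deriv (by simp)
  unfold riemNorm tComp
  fun_prop

theorem intrinsicDist_le {S : Set Heis} {c : ℝ → Heis} (hc : ContDiff ℝ 1 c)
    (hS : ∀ τ ∈ Ico (0 : ℝ) 1, c τ ∈ S) {K : ℝ}
    (hK : ∀ τ ∈ Icc (0 : ℝ) 1, riemNorm (c τ) (deriv c τ) ≤ K) {a b : ℝ}
    (ha : a ∈ Ico (0 : ℝ) 1) (hb : b ∈ Ico (0 : ℝ) 1) :
    intrinsicDist S (c a) (c b) ≤ ENNReal.ofReal (|b - a| * K) := by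
  have hmem : ∀ τ ∈ Icc (0 : ℝ) 1, a + (b - a) * τ ∈ Ico (0 : ℝ) 1 := by
    intro τ hτ
    have hm : max a b < 1 := max_lt ha.2 hb.2
    constructor
    · nlinarith [hτ.1, hτ.2, ha.1, hb.1]
    · nlinarith [hτ.1, hτ.2, le_max_left a b, le_max_right a b]
  refine (iInf₂_le (fun τ => c (a + (b - a) * τ)) ⟨hc.comp (by fun_prop), fun τ hτ =>
    hS _ (hmem τ hτ), by simp, by simp⟩).trans (ENNReal.ofReal_le_ofReal ?_)
  have hd (τ : ℝ) : deriv (fun τ => c (a + (b - a) * τ)) τ =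
      (b - a) • deriv c (a + (b - a) * τ) := by
    have h1 : HasDerivAt (fun τ : ℝ => a + (b - a) * τ) (b - a) τ := by
      simpa using ((hasDerivAt_id τ).const_mul (b - a)).const_add a
    exact ((hc.differentiable (by simp) _).hasDerivAt.scomp τ h1).deriv
  refine (le_abs_self _).trans ?_
  have := intervalIntegral.norm_integral_le_of_norm_le_const (a := 0) (b := 1)
    (f := fun τ => riemNorm (c (a + (b - a) * τ)) (deriv (fun τ => c (a + (b - a) * τ)) τ))
    (C := |b - a| * K) (fun τ hτ => by
      rw [uIoc_of_le zero_le_one] at hτ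
      rw [hd, riemNorm_smul, Real.norm_of_nonneg (mul_nonneg (abs_nonneg _) (riemNorm_nonneg _ _))]
      have := hmem τ ⟨hτ.1.le, hτ.2⟩
      exact mul_le_mul_of_nonneg_left (hK _ ⟨this.1, this.2.le⟩) (abs_nonneg _))
  simpa [curveLength] using this

theorem abs_sub_le_of_abs_deriv_le {y y' ρ : ℝ → ℝ} (hy : ∀ t, HasDerivAt y (y' t) t)
    (hy' : Continuous y') (hρ : Continuous ρ) (hρ0 : ∀ t, 0 ≤ ρ t) {C : ℝ} (hC : 0 ≤ C)
    (hle : ∀ t ∈ Icc (0 : ℝ) 1, |y' t| ≤ C * ρ t) {τ : ℝ} (hτ : τ ∈ Icc (0 : ℝ) 1) :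
    |y τ - y 1| ≤ C * ∫ t in (0 : ℝ)..1, ρ t := by
  have h1 : ∫ t in τ..1, y' t = y 1 - y τ :=
    intervalIntegral.integral_eq_sub_of_hasDerivAt (fun t _ => hy t) (hy'.intervalIntegrable _ _)
  rw [abs_sub_comm, ← h1]
  have h2 : ‖∫ t in τ..1, y' t‖ ≤ ∫ t in τ..1, C * ρ t :=
    intervalIntegral.norm_integral_le_of_norm_le hτ.2
      (Eventually.of_forall fun t ht => hle t ⟨hτ.1.trans ht.1.le, ht.2⟩)
      ((hρ.const_mul C).intervalIntegrable _ _)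
  refine h2.trans ?_
  rw [← intervalIntegral.integral_const_mul]
  exact intervalIntegral.integral_mono_interval hτ.1 hτ.2 le_rfl
    (Eventually.of_forall fun t => mul_nonneg hC (hρ0 t))
    ((hρ.const_mul C).intervalIntegrable _ _)

/-- The intrinsic distance to `p` bounds the Euclidean distance to `p`. -/
theorem exists_dist_le_of_intrinsicDist_lt (S : Set Heis) (p : Heis) :
    ∃ C : ℝ, 0 < C ∧ ∀ (a : Heis) (δ : ℝ), 0 < δ → δ ≤ 1 →
      intrinsicDist S a p < ENNReal.ofReal δ → dist a p ≤ C * δ := by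
  -- Because `δ ≤ 1`, the curve keeps `|x|, |y| ≤ B`. Then `t' = tComp + (x y' - y x') / 2` is at
  -- most `1 + B` times the speed.
  set B : ℝ := |p.1| + |p.2.1| + 1 with hB
  have hB1 : 1 ≤ B := by
    have := abs_nonneg p.1
    have := abs_nonneg p.2.1
    linarith
  refine ⟨1 + B, by linarith, fun a δ hδ hδ1 hlt => ?_⟩
  simp only [intrinsicDist, iInf_lt_iff] at hlt
  obtain ⟨c, ⟨hc, -, hc0, hc1⟩, hlen⟩ := hlt
  have hL : curveLength c < δ := (ENNReal.ofReal_lt_ofReal_iff hδ).1 hlen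
  have hρ := continuous_riemNorm_deriv hc
  have hρ0 (t : ℝ) : 0 ≤ riemNorm (c t) (deriv c t) := riemNorm_nonneg _ _
  have hd (t : ℝ) := hasDerivAt_coords (hc.differentiable (by simp) t).hasDerivAt
  have hdc : Continuous (deriv c) := hc.continuous_deriv (by simp)
  have h1 {τ : ℝ} (hτ : τ ∈ Icc (0 : ℝ) 1) : |(c τ).1 - p.1| ≤ δ := by
    have := abs_sub_le_of_abs_deriv_le (fun t => (hd t).1) (by fun_prop) hρ hρ0 zero_le_one
      (fun t _ => by simpa using abs_fst_le_riemNorm (c t) (deriv c t)) hτ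
    rw [one_mul, hc1] at this
    exact this.trans hL.le
  have h2 {τ : ℝ} (hτ : τ ∈ Icc (0 : ℝ) 1) : |(c τ).2.1 - p.2.1| ≤ δ := by
    have := abs_sub_le_of_abs_deriv_le (fun t => (hd t).2.1) (by fun_prop) hρ hρ0 zero_le_one
      (fun t _ => by simpa using abs_snd_le_riemNorm (c t) (deriv c t)) hτ
    rw [one_mul, hc1] at this
    exact this.trans hL.le
  have h3 {τ : ℝ} (hτ : τ ∈ Icc (0 : ℝ) 1) : |(c τ).2.2 - p.2.2| ≤ (1 + B) * δ := by
    have := abs_sub_le_of_abs_deriv_le (C := 1 + B) (fun t => (hd t).2.2) (by fun_prop) hρ hρ0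
      (by linarith) (fun t ht => by
        have e : (deriv c t).2.2 = tComp (c t) (deriv c t) +
          ((c t).1 * (deriv c t).2.1 - (c t).2.1 * (deriv c t).1) / 2 := by simp [tComp]
        have b1 : |(c t).1| ≤ B := by
          have := abs_sub_abs_le_abs_sub (c t).1 p.1
          have := h1 ht
          have := abs_nonneg p.2.1
          linarith
        have b2 : |(c t).2.1| ≤ B := by
          have := abs_sub_abs_le_abs_sub (c t).2.1 p.2.1
          have := h2 ht
          have := abs_nonneg p.1
          linarith
        have m1 : |(c t).1 * (deriv c t).2.1| ≤ B * riemNorm (c t) (deriv c t) := by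
          rw [abs_mul]
          exact mul_le_mul b1 (abs_snd_le_riemNorm _ _) (abs_nonneg _) (by linarith)
        have m2 : |(c t).2.1 * (deriv c t).1| ≤ B * riemNorm (c t) (deriv c t) := by
          rw [abs_mul]
          exact mul_le_mul b2 (abs_fst_le_riemNorm _ _) (abs_nonneg _) (by linarith)
        have m3 := abs_tComp_le_riemNorm (c t) (deriv c t)
        rw [e]
        rw [abs_le] at m1 m2 m3 ⊢
        constructor <;> linarith [m1.1, m1.2, m2.1, m2.2, m3.1, m3.2]) hτ
    rw [hc1] at this
    exact this.trans (mul_le_mul_of_nonneg_left hL.le (by linarith))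
  have h0 : (0 : ℝ) ∈ Icc (0 : ℝ) 1 := by simp
  have k1 := h1 h0
  have k2 := h2 h0
  have k3 := h3 h0
  rw [hc0] at k1 k2 k3
  have hδB : δ ≤ (1 + B) * δ := by nlinarith
  rw [Prod.dist_eq, Prod.dist_eq, Real.dist_eq, Real.dist_eq, Real.dist_eq]
  exact max_le (k1.trans hδB) (max_le (k2.trans hδB) k3)

/-- The speed is bounded on `[0, 1]`, so points of the curve at times tending to `1` are Cauchy for
the intrinsic distance. Their intrinsic limit is also the Euclidean limit, which is `c 1`. -/
theorem IsCompleteSurface.hasEndpoints {S : Set Heis} (hS : IsCompleteSurface S) :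
    HasEndpoints S := by
  intro c hc hcS
  obtain ⟨K, hK⟩ := (isCompact_Icc (a := (0 : ℝ)) (b := 1)).bddAbove_image
    (continuous_riemNorm_deriv hc).continuousOn
  have hK' : ∀ τ ∈ Icc (0 : ℝ) 1, riemNorm (c τ) (deriv c τ) ≤ K := fun τ hτ =>
    hK (mem_image_of_mem _ hτ)
  have hK0 : 0 ≤ K := (riemNorm_nonneg _ _).trans (hK' 0 (by simp))
  set r : ℕ → ℝ := fun n => 1 - 1 / ((n : ℝ) + 1) with hr
  have hrmem (n : ℕ) : r n ∈ Ico (0 : ℝ) 1 := by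
    have h1 : (0 : ℝ) < 1 / ((n : ℝ) + 1) := by positivity
    have h2 : 1 / ((n : ℝ) + 1) ≤ 1 := by
      rw [div_le_one (by positivity)]
      linarith [(Nat.cast_nonneg n : (0 : ℝ) ≤ n)]
    constructor <;> simp only [hr] <;> linarith
  have hrlim : Tendsto r atTop (𝓝 1) := by
    simpa [hr] using tendsto_one_div_add_atTop_nhds_zero_nat.const_sub (1 : ℝ)
  have hcauchy := Metric.cauchySeq_iff.1 hrlim.cauchySeq
  obtain ⟨p, hp, hlim⟩ := hS (fun n => c (r n)) (fun n => hcS _ (hrmem n)) fun δ hδ => by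
    obtain ⟨δ', hδ', hδδ⟩ := ENNReal.lt_iff_exists_real_btwn.1 hδ
    have hδpos : 0 < δ' := ENNReal.ofReal_pos.1 hδδ.1
    obtain ⟨N, hN⟩ := hcauchy (δ' / (K + 1)) (by positivity)
    refine ⟨N, fun m hm n hn => (intrinsicDist_le hc hcS hK' (hrmem m) (hrmem n)).trans_lt
      (lt_of_le_of_lt (ENNReal.ofReal_le_ofReal ?_) hδδ.2)⟩
    have h1 : |r n - r m| < δ' / (K + 1) := hN n hn m hm
    rw [lt_div_iff₀ (by linarith)] at h1
    nlinarith [abs_nonneg (r n - r m)]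
  obtain ⟨C, hC, hdist⟩ := exists_dist_le_of_intrinsicDist_lt S p
  have hlim' : Tendsto (fun n => c (r n)) atTop (𝓝 p) := by
    rw [Metric.tendsto_atTop]
    intro ε hε
    have hmin : 0 < min 1 (ε / (2 * C)) := by positivity
    obtain ⟨N, hN⟩ := hlim (ENNReal.ofReal (min 1 (ε / (2 * C)))) (by simpa using hmin)
    refine ⟨N, fun n hn => (hdist _ _ hmin (min_le_left _ _) (hN n hn)).trans_lt ?_⟩
    calc C * min 1 (ε / (2 * C)) ≤ C * (ε / (2 * C)) :=
          mul_le_mul_of_nonneg_left (min_le_right _ _) hC.le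
      _ = ε / 2 := by field_simp
      _ < ε := by linarith
  have hlim'' : Tendsto (fun n => c (r n)) atTop (𝓝 (c 1)) :=
    (hc.continuous.tendsto 1).comp hrlim
  rw [tendsto_nhds_unique hlim'' hlim']
  exact hp

/-- Continuity induction: the endpoint property keeps the curve in `M` at the infimum of the exit
times, and `hstep` carries it further. -/
theorem HasEndpoints.mem_of_nonneg {M : Set Heis} (hM : HasEndpoints M) {c : ℝ → Heis}
    (hc : ContDiff ℝ 1 c) (h0 : c 0 ∈ M)
    (hstep : ∀ τ, 0 ≤ τ → (∀ ρ ∈ Icc 0 τ, c ρ ∈ M) → ∀ᶠ ρ in 𝓝[>] τ, c ρ ∈ M) :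
    ∀ τ, 0 ≤ τ → c τ ∈ M := by
  by_contra! hcon
  set B : Set ℝ := {τ | 0 ≤ τ ∧ c τ ∉ M} with hB
  have hne : B.Nonempty := hcon
  have hbdd : BddBelow B := ⟨0, fun τ hτ => hτ.1⟩
  set m := sInf B with hm
  have hm0 : 0 ≤ m := le_csInf hne fun τ hτ => hτ.1
  have hlt : ∀ ρ, 0 ≤ ρ → ρ < m → c ρ ∈ M := by
    intro ρ hρ hρm
    by_contra hn
    exact absurd (csInf_le hbdd (show ρ ∈ B from ⟨hρ, hn⟩)) (not_le.2 hρm)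
  have hcm : c m ∈ M := by
    rcases hm0.eq_or_lt with h | h
    · rwa [← h]
    · have := hM (fun τ => c (m * τ)) (hc.comp (by fun_prop)) fun τ hτ =>
        hlt _ (mul_nonneg hm0 hτ.1) (by nlinarith [hτ.2])
      simpa using this
  have hle : ∀ ρ ∈ Icc 0 m, c ρ ∈ M := fun ρ hρ => by
    rcases hρ.2.eq_or_lt with h | h
    · rwa [h]
    · exact hlt ρ hρ.1 h
  obtain ⟨u, hu, hsub⟩ := (mem_nhdsGT_iff_exists_Ioo_subset).1 (hstep m hm0 hle)
  obtain ⟨τ, hτB, hτu⟩ := exists_lt_of_csInf_lt hne (show sInf B < u from hu)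
  rcases (csInf_le hbdd hτB).eq_or_lt with h | h
  · exact hτB.2 (h ▸ hcm)
  · exact hτB.2 (hsub ⟨h, hτu⟩)

theorem line_mem {S U : Set Heis} {f : Heis → ℝ} (hsurf : IsC2Surface S)
    (hchar : charLocus S = ∅) (hmin : IsHMinimal S) (hend : HasEndpoints S)
    (hf : IsDefiningFunction S U f) {g : Heis} (hgS : g ∈ S) (hgU : g ∈ U) {a b : ℝ}
    (hab : a * dX1 f g + b * dX2 f g = 0) (τ : ℝ) : line g a b τ ∈ S := by
  have key : ∀ a b : ℝ, a * dX1 f g + b * dX2 f g = 0 → ∀ τ, 0 ≤ τ → line g a b τ ∈ S := by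
    intro a b hab
    refine hend.mem_of_nonneg (contDiff_line g a b) (by simpa) fun τ hτ hmem => ?_
    rcases hτ.eq_or_lt with rfl | hpos
    · exact (eventually_line_mem hf hchar hmin hgS hgU hab).filter_mono nhdsWithin_le_nhds
    have hτS : line g a b τ ∈ S := hmem τ ⟨hτ, le_rfl⟩
    obtain ⟨V, k, hV, hk⟩ := hsurf _ hτS
    -- The part of the line already in `S` makes its direction tangent at time `τ`, so the local
    -- result restarts there with the same direction.
    have hfreq : ∃ᶠ ρ in 𝓝[≠] τ, line g a b ρ ∈ S := by
      have : ∀ᶠ ρ in 𝓝[<] τ, line g a b ρ ∈ S := by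
        filter_upwards [Ioo_mem_nhdsLT hpos] with ρ hρ
        exact hmem ρ ⟨hρ.1.le, hρ.2.le⟩
      exact this.frequently.filter_mono (nhdsWithin_mono _ fun ρ hρ => ne_of_lt hρ)
    have htan := (hk.isChart hV).fderiv_apply_eq_zero (hasDerivAt_line g a b τ) hfreq
    have hab' : a * dX1 k (line g a b τ) + b * dX2 k (line g a b τ) = 0 := by
      simpa [dX1, dX2] using htan
    have hloc := eventually_line_mem hk hchar hmin hτS hV hab'
    have hlim : Tendsto (fun ρ : ℝ => ρ - τ) (𝓝[>] τ) (𝓝 0) := by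
      have : Continuous fun ρ : ℝ => ρ - τ := by fun_prop
      simpa using (this.tendsto τ).mono_left nhdsWithin_le_nhds
    filter_upwards [hlim.eventually hloc] with ρ hρ
    simpa [line_line] using hρ
  rcases le_total 0 τ with h | h
  · exact key a b hab τ h
  · have := key (-a) (-b) (by linarith) (-τ) (by linarith)
    have e := line_mul g (-1) a b (-τ)
    simp only [neg_mul, one_mul, neg_neg] at e
    rwa [e] at this

/-! ### Coordinates that straighten `X₁` -/

/-- The coordinates `(x, u, v) = (x, y, t + x y / 2)`, in which `X₁ = ∂ₓ`. -/
noncomputable def ofFlat (z : Heis) : Heis := (z.1, z.2.1, z.2.2 - z.1 * z.2.1 / 2)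

noncomputable def toFlat (z : Heis) : Heis := (z.1, z.2.1, z.2.2 + z.1 * z.2.1 / 2)

@[simp] theorem ofFlat_toFlat (z : Heis) : ofFlat (toFlat z) = z := by simp [ofFlat, toFlat]

@[simp] theorem toFlat_ofFlat (z : Heis) : toFlat (ofFlat z) = z := by simp [ofFlat, toFlat]

theorem contDiff_ofFlat {n : WithTop ℕ∞} : ContDiff ℝ n ofFlat := by unfold ofFlat; fun_prop

theorem contDiff_toFlat {n : WithTop ℕ∞} : ContDiff ℝ n toFlat := by unfold toFlat; fun_prop

/-- The image of `line` in the coordinates `(x, u, v)`. -/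
noncomputable def flatLine (z : Heis) (a b τ : ℝ) : Heis :=
  (z.1 + a * τ, z.2.1 + b * τ, z.2.2 + b * z.1 * τ + a * b * (τ ^ 2 / 2))

theorem ofFlat_flatLine (z : Heis) (a b τ : ℝ) :
    ofFlat (flatLine z a b τ) = line (ofFlat z) a b τ := by
  ext <;> simp [ofFlat, flatLine, line]
  ring

theorem fderiv_ofFlat_apply (z w : Heis) :
    fderiv ℝ ofFlat z w = (w.1, w.2.1, w.2.2 - (z.1 * w.2.1 + z.2.1 * w.1) / 2) := by
  have hl : HasDerivAt (fun τ : ℝ => z + τ • w) w 0 := by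
    simpa using ((hasDerivAt_id (0 : ℝ)).smul_const w).const_add z
  have h1 := ((contDiff_ofFlat (n := 1)).differentiable (by simp)
    (z + (0 : ℝ) • w)).hasFDerivAt.comp_hasDerivAt 0 hl
  obtain ⟨c1, c2, c3⟩ := hasDerivAt_coords hl
  have h2 := c1.prodMk (c2.prodMk (c3.fun_sub ((c1.fun_mul c2).div_const 2)))
  have := h1.unique h2
  simp only [zero_smul, add_zero] at this
  rw [this]
  ext <;> simp
  ring

/-- `h` is a local equation of `M` near `z`, and if `z` lies on `M`, then `∂ₓ` and `∂ᵤ + x ∂ᵥ` are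
not both tangent to `M` at `z`, and each horizontal line that is tangent to `M` at `z` lies in `M`. -/
def IsRuledChart (M : Set Heis) (h : Heis → ℝ) (z : Heis) : Prop :=
  IsChart M h z ∧ (z ∈ M →
    ¬ (fderiv ℝ h z (1, 0, 0) = 0 ∧ fderiv ℝ h z (0, 1, z.1) = 0) ∧
    ∀ a b : ℝ, a * fderiv ℝ h z (1, 0, 0) + b * fderiv ℝ h z (0, 1, z.1) = 0 →
      ∀ τ, flatLine z a b τ ∈ M)

/-- The coordinate form of the complete minimal surfaces without characteristic points. -/
structure IsRuled (M : Set Heis) : Prop where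
  exists_chart : ∀ P ∈ M, ∃ h : Heis → ℝ, ∀ᶠ z in 𝓝 P, IsRuledChart M h z
  hasEndpoints : HasEndpoints M

theorem isRuled_preimage {S : Set Heis} (hsurf : IsC2Surface S)
    (hcomplete : IsCompleteSurface S) (hchar : charLocus S = ∅) (hmin : IsHMinimal S) :
    IsRuled (ofFlat ⁻¹' S) := by
  have hend := hcomplete.hasEndpoints
  refine ⟨fun P hP => ?_, fun c hc hcS => hend (ofFlat ∘ c) (contDiff_ofFlat.comp hc) hcS⟩
  obtain ⟨U, f, hPU, hf⟩ := hsurf _ hP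
  refine ⟨f ∘ ofFlat, ?_⟩
  have hcont : Continuous ofFlat := (contDiff_ofFlat (n := 1)).continuous
  filter_upwards [(hf.isOpen.preimage hcont).mem_nhds hPU] with z hz
  have hch := hf.isChart hz
  have hfd (w : Heis) : fderiv ℝ (f ∘ ofFlat) z w =
      fderiv ℝ f (ofFlat z) (w.1, w.2.1, w.2.2 - (z.1 * w.2.1 + z.2.1 * w.1) / 2) := by
    rw [fderiv_comp z (hch.1.differentiableAt (by simp))
      ((contDiff_ofFlat (n := 1)).differentiable (by simp) z)]
    simp [fderiv_ofFlat_apply]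
  have hX1 : fderiv ℝ (f ∘ ofFlat) z (1, 0, 0) = dX1 f (ofFlat z) := by
    rw [hfd, dX1, X1]
    congr 1
    ext <;> simp [ofFlat]
    ring
  have hX2 : fderiv ℝ (f ∘ ofFlat) z (0, 1, z.1) = dX2 f (ofFlat z) := by
    rw [hfd, dX2, X2]
    congr 1
    ext <;> simp [ofFlat]
    ring
  refine ⟨⟨hch.1.comp z contDiff_ofFlat.contDiffAt, hcont.continuousAt.eventually hch.2⟩,
    fun hzM => ?_⟩
  rw [hX1, hX2]
  refine ⟨fun h0 => ?_, fun a b hab τ => ?_⟩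
  · have : ofFlat z ∈ charLocus S := ⟨hzM, U, f, hz, hf, by simp [W, h0.1, h0.2]⟩
    simp [hchar] at this
  · rw [mem_preimage, ofFlat_flatLine]
    exact line_mem hsurf hchar hmin hend hf hzM hz hab τ

/-! ### Implicit functions, slopes and intrinsic graphs -/

/-- The linear map `e` selects the coordinate to be solved for. The last clause is the chain rule:
`dh` annihilates the tangent vectors of the graph. -/
theorem exists_implicit {E V : Type*} [NormedAddCommGroup E] [NormedSpace ℝ E] [CompleteSpace E]
    [NormedAddCommGroup V] [NormedSpace ℝ V] (e : E × ℝ →L[ℝ] V) {h : V → ℝ} {y : E × ℝ}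
    (hh : ContDiffAt ℝ 2 h (e y)) (h0 : h (e y) = 0) (hd : fderiv ℝ h (e y) (e (0, 1)) ≠ 0) :
    ∃ φ : E → ℝ, ContDiffAt ℝ 2 φ y.1 ∧ φ y.1 = y.2 ∧
      (∀ᶠ z in 𝓝 y, h (e z) = 0 ↔ φ z.1 = z.2) ∧
      ∀ᶠ w in 𝓝 y.1, h (e (w, φ w)) = 0 ∧
        ∀ k, fderiv ℝ h (e (w, φ w)) (e (k, fderiv ℝ φ w k)) = 0 := by
  have hf : ContDiffAt ℝ 2 (h ∘ e) y := hh.comp y e.contDiff.contDiffAt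
  have hfd : fderiv ℝ (h ∘ e) y = (fderiv ℝ h (e y)).comp e :=
    ((hh.differentiableAt (by simp)).hasFDerivAt.comp y e.hasFDerivAt).fderiv
  have hinv : (fderiv ℝ (h ∘ e) y ∘L .inr ℝ E ℝ).IsInvertible := by
    refine ⟨ContinuousLinearEquiv.unitsEquivAut ℝ (Units.mk0 _ hd), ?_⟩
    ext
    simp [hfd]
  have hn : (2 : WithTop ℕ∞) ≠ 0 := by simp
  have hφC := hf.contDiffAt_implicitFunction hn hinv
  have hφ0 := hf.implicitFunction_apply_self hn hinv
  have hφiff := hf.eventually_apply_eq_iff_implicitFunction hn hinv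
  have hφz := hf.eventually_apply_implicitFunction hn hinv
  set φ := hf.implicitFunction hn hinv
  simp only [Function.comp_apply, h0] at hφiff hφz
  refine ⟨φ, hφC, hφ0, hφiff, ?_⟩
  have hcont : ContinuousAt (fun w => e (w, φ w)) y.1 :=
    e.continuous.continuousAt.comp (continuousAt_id.prodMk hφC.continuousAt)
  have hy : e (y.1, φ y.1) = e y := by rw [hφ0]
  have hhd : ∀ᶠ v in 𝓝 (e (y.1, φ y.1)), ContDiffAt ℝ 2 h v := by
    rw [hy]
    exact hh.eventually (by simp)
  filter_upwards [hφz.eventually_nhds, hφC.eventually (by simp), hcont.eventually hhd]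
    with w h1 h2 h3
  refine ⟨h1.self_of_nhds, fun k => ?_⟩
  have hg : HasFDerivAt (fun w => e (w, φ w))
      (e.comp ((ContinuousLinearMap.id ℝ E).prod (fderiv ℝ φ w))) w :=
    e.hasFDerivAt.comp w ((hasFDerivAt_id w).prodMk (h2.differentiableAt (by simp)).hasFDerivAt)
  have hcomp := (h3.differentiableAt (by simp)).hasFDerivAt.comp w hg
  have hzero : HasFDerivAt (h ∘ fun w => e (w, φ w)) (0 : E →L[ℝ] ℝ) w :=
    (hasFDerivAt_const (0 : ℝ) w).congr_of_eventuallyEq h1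
  simpa using DFunLike.congr_fun (hcomp.unique hzero) k

@[simp] theorem flatLine_zero (z : Heis) (a b : ℝ) : flatLine z a b 0 = z := by simp [flatLine]

theorem flatLine_flatLine (z : Heis) (a b τ ρ : ℝ) :
    flatLine (flatLine z a b τ) a b ρ = flatLine z a b (τ + ρ) := by
  ext <;> simp [flatLine] <;> ring

theorem continuous_flatLine (z : Heis) (a b : ℝ) : Continuous (flatLine z a b) := by
  unfold flatLine; fun_prop

theorem hasDerivAt_flatLine_zero (z : Heis) (a b : ℝ) :
    HasDerivAt (flatLine z a b) (a • (1, 0, 0) + b • (0, 1, z.1)) 0 := by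
  have h1 (k l : ℝ) : HasDerivAt (fun τ : ℝ => k + l * τ) l 0 := by
    simpa using ((hasDerivAt_id (0 : ℝ)).const_mul l).const_add k
  have h2 : HasDerivAt (fun τ : ℝ => a * b * (τ ^ 2 / 2)) 0 0 := by
    simpa using (((hasDerivAt_id (0 : ℝ)).pow 2).div_const 2).const_mul (a * b)
  convert! (h1 z.1 a).prodMk ((h1 z.2.1 b).prodMk ((h1 z.2.2 (b * z.1)).fun_add h2)) using 1
  ext <;> simp

/-- The horizontal line through `z` that is not parallel to `∂ₓ` and has slope `G` lies in `M`. -/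
def IsSlope (M : Set Heis) (z : Heis) (G : ℝ) : Prop := ∀ τ, flatLine z G 1 τ ∈ M

theorem IsSlope.mem {M : Set Heis} {z : Heis} {G : ℝ} (hG : IsSlope M z G) : z ∈ M := by
  simpa using hG 0

theorem IsSlope.flatLine {M : Set Heis} {z : Heis} {G : ℝ} (hG : IsSlope M z G) (ρ : ℝ) :
    IsSlope M (flatLine z G 1 ρ) G := fun τ => by
  rw [flatLine_flatLine]
  exact hG _

theorem IsRuledChart.fderiv_eq_zero_of_flatLine {M : Set Heis} {h : Heis → ℝ} {z : Heis}
    (hh : IsRuledChart M h z) {a b : ℝ} (hab : ∀ τ, Heisenberg.flatLine z a b τ ∈ M) :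
    a * fderiv ℝ h z (1, 0, 0) + b * fderiv ℝ h z (0, 1, z.1) = 0 := by
  have h1 : IsChart M h (Heisenberg.flatLine z a b 0) := by simpa using hh.1
  have := h1.fderiv_apply_eq_zero (hasDerivAt_flatLine_zero z a b)
    (Eventually.of_forall fun τ => hab τ).frequently
  rw [flatLine_zero, map_add, map_smul, map_smul] at this
  simpa using this

/-- If `∂ₓ` were tangent besides `G ∂ₓ + (∂ᵤ + x ∂ᵥ)`, the whole horizontal plane would be tangent.
-/
theorem IsRuledChart.fderiv_x_ne_zero {M : Set Heis} {h : Heis → ℝ} {z : Heis}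
    (hh : IsRuledChart M h z) {G : ℝ} (hG : IsSlope M z G) : fderiv ℝ h z (1, 0, 0) ≠ 0 := by
  intro h0
  have := hh.fderiv_eq_zero_of_flatLine hG
  rw [h0] at this
  exact (hh.2 hG.mem).1 ⟨h0, by linarith⟩

theorem IsRuled.slope_unique {M : Set Heis} (hM : IsRuled M) {z : Heis} {G G' : ℝ}
    (hG : IsSlope M z G) (hG' : IsSlope M z G') : G = G' := by
  obtain ⟨h, hh⟩ := hM.exists_chart z hG.mem
  have hz := hh.self_of_nhds
  have h1 := hz.fderiv_eq_zero_of_flatLine hG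
  have h2 := hz.fderiv_eq_zero_of_flatLine hG'
  have : (G - G') * fderiv ℝ h z (1, 0, 0) = 0 := by linear_combination h1 - h2
  exact sub_eq_zero.1 ((mul_eq_zero.1 this).resolve_right (hz.fderiv_x_ne_zero hG))

theorem IsRuledChart.isSlope {M : Set Heis} {h : Heis → ℝ} {z : Heis}
    (hh : IsRuledChart M h z) (hz : z ∈ M) {G : ℝ}
    (hG : G * fderiv ℝ h z (1, 0, 0) + fderiv ℝ h z (0, 1, z.1) = 0) : IsSlope M z G :=
  (hh.2 hz).2 G 1 (by rwa [one_mul])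

/-- Near a point at which `∂ₓ` is not tangent, `M` is an intrinsic graph `x = φ (u, v)`, and
`φᵤ + φ φᵥ` is the slope of the lines. -/
theorem IsRuled.exists_graph {M : Set Heis} (hM : IsRuled M) {P : Heis} {G : ℝ}
    (hG : IsSlope M P G) :
    ∃ φ : ℝ × ℝ → ℝ, ContDiffAt ℝ 2 φ P.2 ∧ φ P.2 = P.1 ∧
      (∀ᶠ z in 𝓝 P, z ∈ M ↔ φ z.2 = z.1) ∧
      ∀ᶠ w in 𝓝 P.2, IsSlope M (φ w, w) (fderiv ℝ φ w (1, φ w)) := by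
  obtain ⟨h, hh⟩ := hM.exists_chart P hG.mem
  have hP := hh.self_of_nhds
  let e : (ℝ × ℝ) × ℝ →L[ℝ] Heis :=
    (ContinuousLinearMap.snd ℝ (ℝ × ℝ) ℝ).prod (ContinuousLinearMap.fst ℝ (ℝ × ℝ) ℝ)
  obtain ⟨φ, hφC, hφP, hφ, hφd⟩ := exists_implicit e (h := h) (y := (P.2, P.1)) hP.1.1
    (hP.1.2.self_of_nhds.1 hG.mem) (hP.fderiv_x_ne_zero hG)
  refine ⟨φ, hφC, hφP, ?_, ?_⟩
  · have hsw : Tendsto (fun z : Heis => (z.2, z.1)) (𝓝 P) (𝓝 (P.2, P.1)) :=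
      Continuous.tendsto (by fun_prop) P
    filter_upwards [hsw.eventually hφ, hP.1.2] with z h1 h2
    exact h2.trans h1
  · have hcont : ContinuousAt (fun w => ((φ w, w) : Heis)) P.2 :=
      hφC.continuousAt.prodMk continuousAt_id
    have hh' : ∀ᶠ z in 𝓝 ((φ P.2, P.2) : Heis), IsRuledChart M h z := by
      rw [hφP]
      exact hh
    filter_upwards [hφd, hcont.eventually hh'] with w h1 h2
    refine h2.isSlope (h2.1.2.self_of_nhds.2 h1.1) ?_
    have h3 := h1.2 (1, φ w)
    -- The tangent vector of the graph over `(1, φ)` is horizontal, and its `∂ₓ`-component is the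
    -- slope.
    have h4 : e ((1, φ w), fderiv ℝ φ w (1, φ w)) =
        fderiv ℝ φ w (1, φ w) • ((1, 0, 0) : Heis) + (0, 1, φ w) := by
      ext <;> simp [e]
    rw [h4, map_add, map_smul] at h3
    exact h3

/-! ### The family of lines parametrized along `u = 0` -/

theorem hasDerivAt_family {F G : ℝ → ℝ} {s : ℝ} (hF : DifferentiableAt ℝ F s)
    (hG : DifferentiableAt ℝ G s) (u : ℝ) :
    HasDerivAt (fun s => flatLine (F s, 0, s) (G s) 1 u)
      (deriv F s + deriv G s * u, 0, 1 + deriv F s * u + deriv G s * (u ^ 2 / 2)) s := by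
  have h1 := hF.hasDerivAt
  have h2 := hG.hasDerivAt
  have hx := h1.fun_add (h2.mul_const u)
  have hv := ((hasDerivAt_id s).fun_add (h1.mul_const u)).fun_add (h2.mul_const (u ^ 2 / 2))
  simpa [flatLine] using hx.prodMk ((hasDerivAt_const s u).prodMk hv)

/-- The variation of the family, `(F' + G' ρ, 0, J ρ)`, is tangent to `M`. If `J u = 0`, then `F' +
G' u = 0` because `∂ₓ` is not tangent, so `J ρ = G' (ρ - u)² / 2`. Dividing the tangency relation by
`G' (ρ - u)` and letting `ρ → u` shows that `∂ₓ` is tangent after all. -/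
theorem IsRuled.jacobian_ne_zero {M : Set Heis} (hM : IsRuled M) {F G : ℝ → ℝ} {s : ℝ}
    (hF : DifferentiableAt ℝ F s) (hG : DifferentiableAt ℝ G s)
    (hs : ∀ᶠ r in 𝓝 s, IsSlope M (F r, 0, r) (G r)) (u : ℝ) :
    1 + deriv F s * u + deriv G s * (u ^ 2 / 2) ≠ 0 := by
  intro hJ
  have hsl : IsSlope M (flatLine (F s, 0, s) (G s) 1 u) (G s) := hs.self_of_nhds.flatLine u
  obtain ⟨h, hh⟩ := hM.exists_chart _ hsl.mem
  have hQ := hh.self_of_nhds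
  have hne := hQ.fderiv_x_ne_zero hsl
  have hlc := (continuous_flatLine (F s, 0, s) (G s) 1).continuousAt (x := u)
  have hrel : ∀ᶠ ρ in 𝓝 u, (deriv F s + deriv G s * ρ) *
      fderiv ℝ h (flatLine (F s, 0, s) (G s) 1 ρ) (1, 0, 0) +
      (1 + deriv F s * ρ + deriv G s * (ρ ^ 2 / 2)) *
        fderiv ℝ h (flatLine (F s, 0, s) (G s) 1 ρ) (0, 0, 1) = 0 := by
    filter_upwards [hlc.eventually hh] with ρ hρ
    have htan := hρ.1.fderiv_apply_eq_zero (c := fun r => flatLine (F r, 0, r) (G r) 1 ρ)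
      (hasDerivAt_family hF hG ρ)
      ((hs.mono fun r hr => hr ρ).filter_mono nhdsWithin_le_nhds).frequently
    have hdec : ((deriv F s + deriv G s * ρ, 0,
        1 + deriv F s * ρ + deriv G s * (ρ ^ 2 / 2)) : Heis) =
        (deriv F s + deriv G s * ρ) • (1, 0, 0) +
        (1 + deriv F s * ρ + deriv G s * (ρ ^ 2 / 2)) • (0, 0, 1) := by
      ext <;> simp
    rw [hdec, map_add, map_smul, map_smul] at htan
    exact htan
  have hx0 : deriv F s + deriv G s * u = 0 := by
    have := hrel.self_of_nhds
    rw [hJ, zero_mul, add_zero] at this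
    exact (mul_eq_zero.1 this).resolve_right hne
  -- Otherwise `F' = 0` as well, and the Jacobian would be `1`.
  have hG0 : deriv G s ≠ 0 := by
    intro h0
    have hF0 : deriv F s = 0 := by simpa [h0] using hx0
    simp [h0, hF0] at hJ
  have hrel' : ∀ᶠ ρ in 𝓝[≠] u, fderiv ℝ h (flatLine (F s, 0, s) (G s) 1 ρ) (1, 0, 0) +
      (ρ - u) / 2 * fderiv ℝ h (flatLine (F s, 0, s) (G s) 1 ρ) (0, 0, 1) = 0 := by
    filter_upwards [hrel.filter_mono nhdsWithin_le_nhds, self_mem_nhdsWithin] with ρ hρ hρu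
    have hρu' : ρ - u ≠ 0 := sub_ne_zero.2 hρu
    have : deriv G s * (ρ - u) * (fderiv ℝ h (flatLine (F s, 0, s) (G s) 1 ρ) (1, 0, 0) +
      (ρ - u) / 2 * fderiv ℝ h (flatLine (F s, 0, s) (G s) 1 ρ) (0, 0, 1)) = 0 := by
      linear_combination hρ - hx0 * fderiv ℝ h (flatLine (F s, 0, s) (G s) 1 ρ) (1, 0, 0) -
        (hJ + (ρ - u) * hx0) * fderiv ℝ h (flatLine (F s, 0, s) (G s) 1 ρ) (0, 0, 1)
    exact (mul_eq_zero.1 this).resolve_left (mul_ne_zero hG0 hρu')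
  have hfc : ContinuousAt (fun ρ => fderiv ℝ h (flatLine (F s, 0, s) (G s) 1 ρ)) u :=
    ContinuousAt.comp (g := fderiv ℝ h)
      (hQ.1.1.fderiv_right (m := 1) (by norm_num)).continuousAt hlc
  have hlim : Tendsto (fun ρ => fderiv ℝ h (flatLine (F s, 0, s) (G s) 1 ρ) (1, 0, 0) +
      (ρ - u) / 2 * fderiv ℝ h (flatLine (F s, 0, s) (G s) 1 ρ) (0, 0, 1)) (𝓝 u)
      (𝓝 (fderiv ℝ h (flatLine (F s, 0, s) (G s) 1 u) (1, 0, 0))) := by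
    have : ContinuousAt (fun ρ => fderiv ℝ h (flatLine (F s, 0, s) (G s) 1 ρ) (1, 0, 0) +
      (ρ - u) / 2 * fderiv ℝ h (flatLine (F s, 0, s) (G s) 1 ρ) (0, 0, 1)) u := by fun_prop
    simpa using this.tendsto
  have hzero := tendsto_nhds_unique (hlim.mono_left nhdsWithin_le_nhds)
    (tendsto_const_nhds.congr' (hrel'.mono fun ρ hρ => hρ.symm))
  exact hne hzero

theorem quadratic_dichotomy {p q : ℝ} (h : ∀ u : ℝ, 1 + p * u + q * (u ^ 2 / 2) ≠ 0) :
    (p = 0 ∧ q = 0) ∨ p ^ 2 < 2 * q := by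
  by_cases hq : q = 0
  · left
    refine ⟨?_, hq⟩
    by_contra hp
    refine h (-1 / p) ?_
    rw [hq]
    field_simp
    ring
  · right
    by_contra! hle
    refine h ((-p + √(p ^ 2 - 2 * q)) / q) ?_
    have := Real.sq_sqrt (show 0 ≤ p ^ 2 - 2 * q by linarith)
    field_simp
    linear_combination this

/-- `F` is the graph function on `u = 0`, hence `C²`, but `G` is built from first derivatives of
`φ`. The missing derivative comes from a second section at a small `u ≠ 0`: the line through `(F s,
0, s)` meets the graph there, and this equation determines `G s` as a `C²` function of `s`. -/
theorem IsRuled.exists_family {M : Set Heis} (hM : IsRuled M) {x₀ s₀ G₀ : ℝ}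
    (hG₀ : IsSlope M (x₀, 0, s₀) G₀) :
    ∃ F G : ℝ → ℝ, ContDiffAt ℝ 2 F s₀ ∧ ContDiffAt ℝ 2 G s₀ ∧ F s₀ = x₀ ∧ G s₀ = G₀ ∧
      (∀ᶠ s in 𝓝 s₀, IsSlope M (F s, 0, s) (G s)) ∧
      ∀ᶠ z in 𝓝 ((x₀, 0, s₀) : Heis), z ∈ M → z.2.1 = 0 → z.1 = F z.2.2 := by
  obtain ⟨φ, hφC, hφ0, hφ, hφs⟩ := hM.exists_graph hG₀
  simp only at hφC hφ0 hφs
  set F : ℝ → ℝ := fun s => φ (0, s) with hFdef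
  set G : ℝ → ℝ := fun s => fderiv ℝ φ (0, s) (1, φ (0, s)) with hGdef
  have hmk : ContDiffAt ℝ 2 (fun s : ℝ => ((0 : ℝ), s)) s₀ := by fun_prop
  have hF : ContDiffAt ℝ 2 F s₀ := ContDiffAt.comp (g := φ) s₀ hφC hmk
  have hGcont : ContinuousAt G s₀ := by
    have h1 : ContinuousAt (fun s : ℝ => fderiv ℝ φ (0, s)) s₀ :=
      ContinuousAt.comp (g := fderiv ℝ φ)
        (hφC.fderiv_right (m := 1) (by norm_num)).continuousAt hmk.continuousAt
    exact h1.clm_apply (continuousAt_const.prodMk hF.continuousAt)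
  have hsl : ∀ᶠ s in 𝓝 s₀, IsSlope M (F s, 0, s) (G s) := hmk.continuousAt.eventually hφs
  have hF0 : F s₀ = x₀ := hφ0
  have hG0 : G s₀ = G₀ := by
    have := hsl.self_of_nhds
    rw [hF0] at this
    exact hM.slope_unique this hG₀
  refine ⟨F, G, hF, ?_, hF0, hG0, hsl, ?_⟩
  swap
  · filter_upwards [hφ] with z hz hzM hz0
    rw [← hz.1 hzM, hFdef]
    simp only
    rw [← hz0]
  have hgood : ∀ᶠ z in 𝓝 ((x₀, 0, s₀) : Heis), ContDiffAt ℝ 2 φ z.2 ∧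
      (∀ᶠ y in 𝓝 z, y ∈ M ↔ φ y.2 = y.1) ∧
      1 - z.2.1 / 2 * fderiv ℝ φ z.2 (0, 1) ≠ 0 := by
    have hsnd : ContinuousAt (fun z : Heis => z.2) (x₀, 0, s₀) := continuousAt_snd
    refine (hsnd.eventually (hφC.eventually (by simp))).and (hφ.eventually_nhds.and ?_)
    have h1 : ContinuousAt (fun z : Heis => fderiv ℝ φ z.2) (x₀, 0, s₀) :=
      ContinuousAt.comp (g := fderiv ℝ φ)
        (hφC.fderiv_right (m := 1) (by norm_num)).continuousAt hsnd
    have h2 : ContinuousAt (fun z : Heis => 1 - z.2.1 / 2 * fderiv ℝ φ z.2 (0, 1))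
      (x₀, 0, s₀) := by fun_prop
    exact h2.eventually_ne (by simp)
  have hk : Tendsto (flatLine (x₀, 0, s₀) G₀ 1) (𝓝[≠] 0) (𝓝 (x₀, 0, s₀)) := by
    simpa using ((continuous_flatLine (x₀, 0, s₀) G₀ 1).tendsto 0).mono_left nhdsWithin_le_nhds
  -- `hu0` and `hu3` make the derivative of the equation below in the slope variable, `u (1 - (u /
  -- 2) φᵥ)`, nonzero.
  obtain ⟨u, ⟨hu1, hu2, hu3⟩, hu0⟩ := ((hk.eventually hgood).and self_mem_nhdsWithin).exists
  simp only [flatLine, zero_add, one_mul, mul_one] at hu1 hu3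
  let h : ℝ × ℝ → ℝ := fun y =>
    F y.1 + y.2 * u - φ (u, y.1 + F y.1 * u + y.2 * (u ^ 2 / 2))
  have hFy : ContDiffAt ℝ 2 (fun y : ℝ × ℝ => F y.1) (s₀, G₀) :=
    ContDiffAt.comp (g := F) (s₀, G₀) hF contDiffAt_fst
  have hin : ContDiffAt ℝ 2 (fun y : ℝ × ℝ => (u, y.1 + F y.1 * u + y.2 * (u ^ 2 / 2)))
      (s₀, G₀) := by fun_prop
  have hhC : ContDiffAt ℝ 2 h (s₀, G₀) := by
    refine ContDiffAt.sub (by fun_prop) (ContDiffAt.comp (g := φ) (s₀, G₀) ?_ hin)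
    simpa only [hF0] using hu1
  have hzero : ∀ᶠ s in 𝓝 s₀, h (s, G s) = 0 := by
    have hc : ContinuousAt (fun s => flatLine (F s, 0, s) (G s) 1 u) s₀ := by
      have := hF.continuousAt
      unfold flatLine
      fun_prop
    have hu2' : ∀ᶠ y in 𝓝 (flatLine (F s₀, 0, s₀) (G s₀) 1 u), y ∈ M ↔ φ y.2 = y.1 := by
      rw [hF0, hG0]
      exact hu2
    filter_upwards [hc.eventually hu2', hsl] with s h1 h2
    have := h1.1 (h2 u)
    simp only [flatLine, zero_add, one_mul, mul_one] at this
    simp only [h]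
    rw [this, sub_self]
  have hd : fderiv ℝ h (s₀, G₀) (0, 1) ≠ 0 := by
    have hl : HasDerivAt (fun γ : ℝ => (s₀, γ)) (0, 1) G₀ :=
      (hasDerivAt_const G₀ s₀).prodMk (hasDerivAt_id G₀)
    have h1 : HasDerivAt (h ∘ fun γ : ℝ => (s₀, γ)) (fderiv ℝ h (s₀, G₀) (0, 1)) G₀ :=
      (hhC.differentiableAt (by simp)).hasFDerivAt.comp_hasDerivAt G₀ hl
    have hv : HasDerivAt (fun γ : ℝ => (u, s₀ + x₀ * u + γ * (u ^ 2 / 2))) (0, u ^ 2 / 2) G₀ :=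
      (hasDerivAt_const G₀ u).prodMk
        (by simpa using ((hasDerivAt_id G₀).mul_const (u ^ 2 / 2)).const_add (s₀ + x₀ * u))
    have h2 : HasDerivAt (fun γ : ℝ => φ (u, s₀ + x₀ * u + γ * (u ^ 2 / 2)))
        (fderiv ℝ φ (u, s₀ + x₀ * u + G₀ * (u ^ 2 / 2)) (0, u ^ 2 / 2)) G₀ :=
      HasFDerivAt.comp_hasDerivAt (l := φ) G₀ (hu1.differentiableAt (by simp)).hasFDerivAt hv
    have h3 := (((hasDerivAt_id G₀).mul_const u).const_add x₀).fun_sub h2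
    have h4 : (h ∘ fun γ : ℝ => (s₀, γ)) = fun γ =>
        x₀ + id γ * u - φ (u, s₀ + x₀ * u + γ * (u ^ 2 / 2)) := by
      ext γ
      simp [h, hF0]
    rw [h4] at h1
    have h5 : ((0, u ^ 2 / 2) : ℝ × ℝ) = (u ^ 2 / 2) • (0, 1) := by ext <;> simp
    rw [h1.unique h3, h5, map_smul, smul_eq_mul]
    have h6 := mul_ne_zero (show u ≠ 0 from hu0) hu3
    intro h7
    apply h6
    linear_combination h7
  obtain ⟨ψ, hψC, -, hψ, -⟩ := exists_implicit (ContinuousLinearMap.id ℝ (ℝ × ℝ)) (h := h)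
    (y := (s₀, G₀)) hhC (by simpa [hG0] using hzero.self_of_nhds) hd
  refine hψC.congr_of_eventuallyEq ?_
  have hc : Tendsto (fun s => (s, G s)) (𝓝 s₀) (𝓝 (s₀, G₀)) := by
    have := (continuousAt_id.prodMk hGcont).tendsto
    rwa [hG0] at this
  filter_upwards [hc.eventually hψ, hzero] with s h1 h2
  exact (h1.1 h2).symm

/-! ### Construction of strict strips -/

theorem mul_eq_ofFlat (x : ℝ) (w : ℝ × ℝ) : mul (0, w.1, w.2) (x, 0, 0) = ofFlat (x, w) := by
  ext <;> simp [mul, ofFlat]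
  ring

theorem mem_image_mul_iff {φ : ℝ × ℝ → ℝ} {Ω : Set (ℝ × ℝ)} {g : Heis} :
    g ∈ (fun w : ℝ × ℝ => mul (0, w.1, w.2) (φ w, 0, 0)) '' Ω ↔
      (toFlat g).2 ∈ Ω ∧ g.1 = φ (toFlat g).2 := by
  simp only [mul_eq_ofFlat]
  constructor
  · rintro ⟨w, hw, rfl⟩
    rw [toFlat_ofFlat]
    exact ⟨hw, rfl⟩
  · rintro ⟨hw, hg⟩
    refine ⟨_, hw, ?_⟩
    simp only
    rw [← hg]
    exact ofFlat_toFlat g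

/-- An intrinsic graph over an open set is a surface. -/
theorem isC2Surface_intrinsicGraph {φ : ℝ × ℝ → ℝ} {Ω : Set (ℝ × ℝ)} (hΩ : IsOpen Ω)
    (hφ : ContDiffOn ℝ 2 φ Ω) :
    IsC2Surface ((fun w : ℝ × ℝ => mul (0, w.1, w.2) (φ w, 0, 0)) '' Ω) := by
  intro g hg
  have hcont : Continuous fun g : Heis => (toFlat g).2 :=
    (contDiff_toFlat (n := 1)).continuous.snd
  have hC : ∀ z ∈ (fun g : Heis => (toFlat g).2) ⁻¹' Ω,
      ContDiffAt ℝ 2 (fun g : Heis => g.1 - φ (toFlat g).2) z := fun z hz =>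
    contDiffAt_fst.sub (ContDiffAt.comp (g := φ) z (hφ.contDiffAt (hΩ.mem_nhds hz))
      contDiff_toFlat.snd.contDiffAt)
  refine ⟨(fun g : Heis => (toFlat g).2) ⁻¹' Ω, fun g => g.1 - φ (toFlat g).2,
    (mem_image_mul_iff.1 hg).1, hΩ.preimage hcont, fun z hz => (hC z hz).contDiffWithinAt,
    fun z hz h0 => ?_, ?_⟩
  -- Moving along `X₁` leaves `(u, v)` fixed, so the defining function has derivative `1` in that
  -- direction.
  · have hl : HasDerivAt (fun τ : ℝ => z + τ • X1 z) (X1 z) 0 := by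
      simpa using ((hasDerivAt_id (0 : ℝ)).smul_const (X1 z)).const_add z
    have hz' : ContDiffAt ℝ 2 (fun g : Heis => g.1 - φ (toFlat g).2) (z + (0 : ℝ) • X1 z) := by
      simpa using hC z hz
    have h1 := (hz'.differentiableAt (by simp)).hasFDerivAt.comp_hasDerivAt 0 hl
    have h2 : ((fun g : Heis => g.1 - φ (toFlat g).2) ∘ fun τ : ℝ => z + τ • X1 z) =
        fun τ => z.1 + τ - φ (toFlat z).2 := by
      ext τ
      have : (toFlat (z + τ • X1 z)).2 = (toFlat z).2 := by
        ext <;> simp [toFlat, X1]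
        ring
      simp only [Function.comp_apply, this]
      simp [X1]
    have h3 : HasDerivAt (fun τ : ℝ => z.1 + τ - φ (toFlat z).2) 1 0 := by
      simpa using ((hasDerivAt_id (0 : ℝ)).const_add z.1).sub_const (φ (toFlat z).2)
    rw [h2] at h1
    have h4 := h1.unique h3
    simp [h0] at h4
  · ext z
    simp only [mem_inter_iff, mem_image_mul_iff, mem_preimage, mem_ofPred_eq, sub_eq_zero]
    tauto

theorem quadratic_pos {p q : ℝ} (h : p ^ 2 < 2 * q) (u : ℝ) :
    0 < 1 + p * u + q * (u ^ 2 / 2) := by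
  have hq : 0 < q := by nlinarith [sq_nonneg p]
  have : 0 < q * (1 + p * u + q * (u ^ 2 / 2)) := by nlinarith [sq_nonneg (q * u + p)]
  exact pos_of_mul_pos_right this hq.le

/-- Strictness is an open condition in `s` and makes `v` strictly increasing in `s` for each `u`. So
the lines over a short interval are disjoint and sweep out a graph. -/
theorem exists_strip {S : Set Heis} {F G : ℝ → ℝ} {s₀ : ℝ} (hF : ContDiffAt ℝ 2 F s₀)
    (hG : ContDiffAt ℝ 2 G s₀) (hstrict : deriv F s₀ ^ 2 < 2 * deriv G s₀)
    (hs : ∀ᶠ s in 𝓝 s₀, IsSlope (ofFlat ⁻¹' S) (F s, 0, s) (G s)) :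
    ∃ (ε : ℝ) (S₀ : Set Heis), IsStrictIntrinsicGraphicalStrip ε S₀ ∧ S₀ ⊆ S := by
  have hlt : ∀ᶠ s in 𝓝 s₀, deriv F s ^ 2 < 2 * deriv G s := by
    have h1 : ContinuousAt (deriv F) s₀ :=
      (hF.derivWithin (m := 1) (by norm_num)).continuousAt
    have h2 : ContinuousAt (deriv G) s₀ :=
      (hG.derivWithin (m := 1) (by norm_num)).continuousAt
    exact (h1.pow 2).eventually_lt (h2.const_mul 2) hstrict
  obtain ⟨δ, hδ, hball⟩ := Metric.eventually_nhds_iff.1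
    (((hF.eventually (by simp)).and (hG.eventually (by simp))).and (hlt.and hs))
  set J : Set ℝ := Ioo (-(4 * (δ / 4))) (4 * (δ / 4)) with hJ
  have hJo : IsOpen J := isOpen_Ioo
  have hJball : ∀ r ∈ J, dist (s₀ + r) s₀ < δ := by
    intro r hr
    rw [Real.dist_eq, add_sub_cancel_left, abs_lt]
    constructor <;> linarith [hr.1, hr.2]
  set F₁ : ℝ → ℝ := fun r => F (s₀ + r) with hF₁
  set G₁ : ℝ → ℝ := fun r => G (s₀ + r) with hG₁
  -- The shift centres the interval at `0`; `σ' = 1` turns the strip inequality into `F'² < 2 G'`.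
  set σ : ℝ → ℝ := fun r => s₀ + r with hσ
  have hF₁C : ∀ r ∈ J, ContDiffAt ℝ 2 F₁ r := fun r hr =>
    ContDiffAt.comp (g := F) r (hball (hJball r hr)).1.1 (by fun_prop)
  have hG₁C : ∀ r ∈ J, ContDiffAt ℝ 2 G₁ r := fun r hr =>
    ContDiffAt.comp (g := G) r (hball (hJball r hr)).1.2 (by fun_prop)
  have hσd : ∀ r, HasDerivAt σ 1 r := fun r => by
    simpa using (hasDerivAt_id r).const_add s₀
  have hstrict₁ : ∀ r ∈ J, deriv F₁ r ^ 2 < 2 * deriv G₁ r := by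
    intro r hr
    rw [deriv_comp_const_add, deriv_comp_const_add]
    exact (hball (hJball r hr)).2.1
  have hv (u : ℝ) : ∀ r ∈ J, HasDerivAt (fun r => (Psi F₁ G₁ σ (u, r)).2)
      (deriv G₁ r * (u ^ 2 / 2) + deriv F₁ r * u + 1) r := fun r hr =>
    ((((hG₁C r hr).differentiableAt (by simp)).hasDerivAt.mul_const (u ^ 2 / 2)).fun_add
      (((hF₁C r hr).differentiableAt (by simp)).hasDerivAt.mul_const u)).fun_add (hσd r)
  have hvpos (u : ℝ) : ∀ r ∈ J, 0 < deriv G₁ r * (u ^ 2 / 2) + deriv F₁ r * u + 1 :=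
    fun r hr => by linarith [quadratic_pos (hstrict₁ r hr) u]
  have hmono (u : ℝ) : StrictMonoOn (fun r => (Psi F₁ G₁ σ (u, r)).2) J :=
    strictMonoOn_of_deriv_pos (convex_Ioo _ _)
      (fun r hr => (hv u r hr).continuousAt.continuousWithinAt) fun r hr => by
        rw [hJo.interior_eq] at hr
        rw [(hv u r hr).deriv]
        exact hvpos u r hr
  have hinj : InjOn (Psi F₁ G₁ σ) (univ ×ˢ J) := by
    rintro ⟨u, r⟩ ⟨-, hr⟩ ⟨u', r'⟩ ⟨-, hr'⟩ he
    obtain rfl : u = u' := congrArg Prod.fst he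
    have := (hmono u).injOn hr hr' (congrArg Prod.snd he)
    simpa using this
  set Ω : Set (ℝ × ℝ) := Psi F₁ G₁ σ '' (univ ×ˢ J) with hΩdef
  set ι : ℝ × ℝ → ℝ × ℝ := Function.invFunOn (Psi F₁ G₁ σ) (univ ×ˢ J) with hι
  have hιΨ : ∀ u, ∀ r ∈ J, ι (Psi F₁ G₁ σ (u, r)) = (u, r) := fun u r hr =>
    hinj.leftInvOn_invFunOn (show (u, r) ∈ univ ×ˢ J from ⟨mem_univ _, hr⟩)
  set φ : ℝ × ℝ → ℝ := fun w => F₁ (ι w).2 + w.1 * G₁ (ι w).2 with hφdef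
  have hφΨ : ∀ u, ∀ r ∈ J, φ (Psi F₁ G₁ σ (u, r)) = F₁ r + u * G₁ r := fun u r hr => by
    simp only [hφdef, hιΨ u r hr]
    rfl
  -- Solving `v = G u²/2 + F u + σ` for the parameter gives both the openness of `Ω` and the
  -- regularity of `φ`.
  have hloc : ∀ w ∈ Ω, (∀ᶠ y in 𝓝 w, y ∈ Ω) ∧ ContDiffAt ℝ 2 φ w := by
    rintro _ ⟨⟨u, r⟩, ⟨-, hr⟩, rfl⟩
    set w₀ := Psi F₁ G₁ σ (u, r) with hw₀
    let h : (ℝ × ℝ) × ℝ → ℝ := fun y => (Psi F₁ G₁ σ (y.1.1, y.2)).2 - y.1.2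
    have hFy : ContDiffAt ℝ 2 (fun y : (ℝ × ℝ) × ℝ => F₁ y.2) (w₀, r) :=
      ContDiffAt.comp (g := F₁) (w₀, r) (hF₁C r hr) contDiffAt_snd
    have hGy : ContDiffAt ℝ 2 (fun y : (ℝ × ℝ) × ℝ => G₁ y.2) (w₀, r) :=
      ContDiffAt.comp (g := G₁) (w₀, r) (hG₁C r hr) contDiffAt_snd
    have hhC : ContDiffAt ℝ 2 h (w₀, r) := by
      simp only [h, Psi, hσ]
      fun_prop
    have hd : fderiv ℝ h (w₀, r) (0, 1) ≠ 0 := by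
      have hl : HasDerivAt (fun ρ : ℝ => (w₀, ρ)) (0, 1) r :=
        (hasDerivAt_const r w₀).prodMk (hasDerivAt_id r)
      have h1 : HasDerivAt (h ∘ fun ρ : ℝ => (w₀, ρ)) (fderiv ℝ h (w₀, r) (0, 1)) r :=
        (hhC.differentiableAt (by simp)).hasFDerivAt.comp_hasDerivAt r hl
      have h2 := (hv u r hr).sub_const w₀.2
      rw [h1.unique h2]
      exact (hvpos u r hr).ne'
    obtain ⟨ψ, hψC, hψr, -, hψ⟩ := exists_implicit
      (ContinuousLinearMap.id ℝ ((ℝ × ℝ) × ℝ)) (h := h) (y := (w₀, r)) hhC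
      (sub_self w₀.2) hd
    have hψJ : ∀ᶠ y in 𝓝 w₀, ψ y ∈ J :=
      hψC.continuousAt.eventually (by rw [hψr]; exact hJo.mem_nhds hr)
    have hψΨ : ∀ᶠ y in 𝓝 w₀, ψ y ∈ J ∧ Psi F₁ G₁ σ (y.1, ψ y) = y := by
      filter_upwards [hψJ, hψ] with y h1 h2
      exact ⟨h1, Prod.ext rfl (sub_eq_zero.1 h2.1)⟩
    refine ⟨hψΨ.mono fun y hy => ⟨(y.1, ψ y), ⟨mem_univ _, hy.1⟩, hy.2⟩, ?_⟩
    have hFψ : ContDiffAt ℝ 2 (fun y => F₁ (ψ y)) w₀ :=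
      ContDiffAt.comp (g := F₁) w₀ (by rw [hψr]; exact hF₁C r hr) hψC
    have hGψ : ContDiffAt ℝ 2 (fun y => G₁ (ψ y)) w₀ :=
      ContDiffAt.comp (g := G₁) w₀ (by rw [hψr]; exact hG₁C r hr) hψC
    refine (hFψ.add (contDiffAt_fst.mul hGψ)).congr_of_eventuallyEq ?_
    filter_upwards [hψΨ] with y hy
    have := hφΨ y.1 (ψ y) hy.1
    rw [hy.2] at this
    exact this
  have hΩo : IsOpen Ω := isOpen_iff_mem_nhds.2 fun w hw => (hloc w hw).1
  have hφC : ContDiffOn ℝ 2 φ Ω := fun w hw => (hloc w hw).2.contDiffWithinAt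
  refine ⟨δ / 4, (fun w : ℝ × ℝ => mul (0, w.1, w.2) (φ w, 0, 0)) '' Ω,
    ⟨by positivity, isC2Surface_intrinsicGraph hΩo hφC, F₁, G₁, σ,
      fun r hr => (hF₁C r hr).contDiffWithinAt, fun r hr => (hG₁C r hr).contDiffWithinAt,
      by fun_prop, fun r hr => ?_, hinj, Ω, φ, rfl, hφC, hφΨ, rfl⟩, ?_⟩
  · rw [(hσd r).deriv, mul_one]
    exact hstrict₁ r hr
  · rintro _ ⟨_, ⟨⟨u, r⟩, ⟨-, hr⟩, rfl⟩, rfl⟩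
    have := (hball (hJball r hr)).2.2 u
    simp only [mul_eq_ofFlat, hφΨ u r hr]
    rw [mem_preimage] at this
    convert this using 2
    ext <;> simp [flatLine, Psi, hF₁, hG₁, hσ] <;> ring

/-! ### Rigidity in the absence of strict strips -/

theorem eventually_eq_of_fderiv_eq_zero {E : Type*} [NormedAddCommGroup E] [NormedSpace ℝ E]
    {k : E → ℝ} {a : E} (hk : ∀ᶠ x in 𝓝 a, DifferentiableAt ℝ k x ∧ fderiv ℝ k x = 0) :
    ∀ᶠ x in 𝓝 a, k x = k a := by
  obtain ⟨δ, hδ, hball⟩ := Metric.eventually_nhds_iff_ball.1 hk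
  filter_upwards [Metric.ball_mem_nhds a hδ] with x hx
  exact Metric.isOpen_ball.is_const_of_fderiv_eq_zero (convex_ball a δ).isPreconnected
    (fun y hy => (hball y hy).1.differentiableWithinAt) (fun y hy => (hball y hy).2) hx
    (Metric.mem_ball_self hδ)

theorem eventually_eq_of_deriv_eq_zero {k : ℝ → ℝ} {a : ℝ} (hC : ContDiffAt ℝ 2 k a)
    (hk : ∀ᶠ x in 𝓝 a, deriv k x = 0) : ∀ᶠ x in 𝓝 a, k x = k a := by
  refine eventually_eq_of_fderiv_eq_zero ?_
  filter_upwards [hC.eventually (by simp), hk] with x h1 h2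
  refine ⟨h1.differentiableAt (by simp), ?_⟩
  ext
  simpa using h2

theorem subset_of_isPreconnected {X : Type*} [TopologicalSpace X] {M A : Set X}
    (hM : IsPreconnected M) (h1 : ∀ p ∈ M, p ∈ A → ∀ᶠ q in 𝓝 p, q ∈ M → q ∈ A)
    (h2 : ∀ p ∈ M, p ∉ A → ∀ᶠ q in 𝓝 p, q ∈ M → q ∉ A) (hne : (M ∩ A).Nonempty) : M ⊆ A := by
  intro p hp
  by_contra hpA
  obtain ⟨q, hqM, hqA⟩ := hne
  obtain ⟨z, hzM, hz1, hz2⟩ := hM (interior {q | q ∈ M → q ∈ A}) (interior {q | q ∈ M → q ∉ A})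
    isOpen_interior isOpen_interior
    (fun z hz => by
      by_cases hzA : z ∈ A
      · exact Or.inl (mem_interior_iff_mem_nhds.2 (h1 z hz hzA))
      · exact Or.inr (mem_interior_iff_mem_nhds.2 (h2 z hz hzA)))
    ⟨q, hqM, mem_interior_iff_mem_nhds.2 (h1 q hqM hqA)⟩
    ⟨p, hp, mem_interior_iff_mem_nhds.2 (h2 p hp hpA)⟩
  exact interior_subset hz2 hzM (interior_subset hz1 hzM)

/-- The segment from `P` to `z` lies in the plane; local containment and the endpoint property keep
it in `M`. -/
theorem HasEndpoints.mem_of_plane {M : Set Heis} (hM : HasEndpoints M) {a b γ : ℝ} {P : Heis}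
    (hP : P ∈ M) (hsub : ∀ z ∈ M, a * z.1 + b * z.2.1 = γ)
    (hloc : ∀ p ∈ M, ∀ᶠ z in 𝓝 p, a * z.1 + b * z.2.1 = γ → z ∈ M) {z : Heis}
    (hz : a * z.1 + b * z.2.1 = γ) : z ∈ M := by
  have hc : ContDiff ℝ 1 fun τ : ℝ => P + τ • (z - P) := by fun_prop
  have := hM.mem_of_nonneg hc (by simpa using hP) (fun τ hτ hmem => ?_) 1 zero_le_one
  · simpa using this
  · filter_upwards [(hc.continuous.continuousAt.eventually
      (hloc _ (hmem τ ⟨hτ, le_rfl⟩))).filter_mono nhdsWithin_le_nhds] with ρ hρ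
    refine hρ ?_
    have := hsub P hP
    simp
    linear_combination (1 - ρ) * this + ρ * hz

/-- Without strict strips, the lines that meet `M` near a point have the same slope and lie in the
same vertical plane. -/
theorem IsRuled.eventually_isSlope {M : Set Heis} (hM : IsRuled M)
    (hflat : ∀ (F G : ℝ → ℝ) (s : ℝ), ContDiffAt ℝ 2 F s → ContDiffAt ℝ 2 G s →
      (∀ᶠ r in 𝓝 s, IsSlope M (F r, 0, r) (G r)) → ¬ deriv F s ^ 2 < 2 * deriv G s)
    {P : Heis} {G₀ : ℝ} (hG₀ : IsSlope M P G₀) :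
    ∀ᶠ p in 𝓝 P, p ∈ M → IsSlope M p G₀ ∧ p.1 - G₀ * p.2.1 = P.1 - G₀ * P.2.1 := by
  -- Sliding along the line to `u = 0` preserves `x - G₀ u`; the family is available there.
  have hbase : flatLine P G₀ 1 (-P.2.1) =
      (P.1 - G₀ * P.2.1, 0, (flatLine P G₀ 1 (-P.2.1)).2.2) := by
    ext <;> simp [flatLine]
    ring
  have hG₁ := hG₀.flatLine (-P.2.1)
  set s₀ := (flatLine P G₀ 1 (-P.2.1)).2.2
  set x₀ := P.1 - G₀ * P.2.1 with hx₀
  rw [hbase] at hG₁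
  obtain ⟨F, G, hF, hG, hF0, hG0, hsl, hcurve⟩ := hM.exists_family hG₁
  have hder : ∀ᶠ s in 𝓝 s₀, deriv F s = 0 ∧ deriv G s = 0 := by
    filter_upwards [hF.eventually (by simp), hG.eventually (by simp), hsl.eventually_nhds]
      with s h1 h2 h3
    exact (quadratic_dichotomy (hM.jacobian_ne_zero (h1.differentiableAt (by simp))
      (h2.differentiableAt (by simp)) h3)).resolve_right (hflat F G s h1 h2 h3)
  have hFc := eventually_eq_of_deriv_eq_zero hF (hder.mono fun s hs => hs.1)
  have hGc := eventually_eq_of_deriv_eq_zero hG (hder.mono fun s hs => hs.2)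
  have hsec : ∀ᶠ z in 𝓝 ((x₀, 0, s₀) : Heis), z ∈ M → z.2.1 = 0 →
      z.1 = x₀ ∧ IsSlope M z G₀ := by
    have ht : Tendsto (fun z : Heis => z.2.2) (𝓝 (x₀, 0, s₀)) (𝓝 s₀) :=
      Continuous.tendsto (by fun_prop : Continuous fun z : Heis => z.2.2) (x₀, 0, s₀)
    filter_upwards [hcurve, ht.eventually (hFc.and (hGc.and hsl))] with z h1 ⟨h2, h3, h4⟩ hzM hz0
    have h5 := h1 hzM hz0
    refine ⟨by rw [h5, h2, hF0], ?_⟩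
    have h6 : z = (F z.2.2, 0, z.2.2) := Prod.ext h5 (Prod.ext hz0 rfl)
    rw [h6, ← hG0, ← h3]
    exact h4
  obtain ⟨φ, hφC, hφP, hφ, hφs⟩ := hM.exists_graph hG₀
  set g : ℝ × ℝ → ℝ := fun w => fderiv ℝ φ w (1, φ w) with hg
  have hgP : g P.2 = G₀ := by
    have := hφs.self_of_nhds
    rw [hφP] at this
    exact hM.slope_unique (by simpa [hg, hφP] using this) hG₀
  have hgc : ContinuousAt (fun p : Heis => g p.2) P := by
    have h1 : ContinuousAt g P.2 := (hφC.fderiv_right (m := 1) (by norm_num)).continuousAt.clm_apply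
      (continuousAt_const.prodMk hφC.continuousAt)
    exact ContinuousAt.comp (g := g) h1 continuousAt_snd
  -- Each nearby point slides along its own line to `u = 0`. The slope varies continuously, so it
  -- lands where `hsec` applies.
  have hproj : Tendsto (fun p : Heis => flatLine p (g p.2) 1 (-p.2.1)) (𝓝 P)
      (𝓝 (x₀, 0, s₀)) := by
    have hfl : Continuous fun y : Heis × ℝ => flatLine y.1 y.2 1 (-y.1.2.1) := by
      unfold flatLine
      fun_prop
    have := (hfl.continuousAt.comp (continuousAt_id.prodMk hgc)).tendsto
    simp only [Function.comp_apply, id_eq] at this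
    rwa [hgP, hbase] at this
  filter_upwards [hproj.eventually hsec, hφ, continuousAt_snd.eventually hφs] with p h1 h2 h3 hpM
  have hps : IsSlope M p (g p.2) := by
    have h4 := h2.1 hpM
    have h5 : ((φ p.2, p.2) : Heis) = p := Prod.ext h4 rfl
    rwa [h5] at h3
  obtain ⟨h6, h7⟩ := h1 (hps _) (by simp [flatLine])
  have h8 : g p.2 = G₀ := hM.slope_unique (hps.flatLine _) h7
  refine ⟨h8 ▸ hps, ?_⟩
  rw [h8] at h6
  simp only [flatLine] at h6
  linarith

/-- The points with slope `G₀` in the given plane are open and closed in `M`, so `M` lies in the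
plane; continuation along segments gives the converse. -/
theorem IsRuled.eq_plane_of_isSlope {M : Set Heis} (hM : IsRuled M) (hconn : IsPreconnected M)
    (hflat : ∀ (F G : ℝ → ℝ) (s : ℝ), ContDiffAt ℝ 2 F s → ContDiffAt ℝ 2 G s →
      (∀ᶠ r in 𝓝 s, IsSlope M (F r, 0, r) (G r)) → ¬ deriv F s ^ 2 < 2 * deriv G s)
    {P : Heis} {G₀ : ℝ} (hG₀ : IsSlope M P G₀) (z : Heis) :
    z ∈ M ↔ 1 * z.1 + -G₀ * z.2.1 = P.1 - G₀ * P.2.1 := by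
  have hsub : M ⊆ {p | IsSlope M p G₀ ∧ p.1 - G₀ * p.2.1 = P.1 - G₀ * P.2.1} := by
    refine subset_of_isPreconnected hconn (fun p _ hpA => ?_) (fun p hp hpA => ?_)
      ⟨P, hG₀.mem, hG₀, rfl⟩
    · filter_upwards [hM.eventually_isSlope hflat hpA.1] with q hq hqM
      exact ⟨(hq hqM).1, (hq hqM).2.trans hpA.2⟩
    · by_cases hx : p.1 - G₀ * p.2.1 = P.1 - G₀ * P.2.1
      · have hns : ¬ IsSlope M p G₀ := fun h => hpA ⟨h, hx⟩
        obtain ⟨h, hh⟩ := hM.exists_chart p hp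
        have hhp := hh.self_of_nhds
        have hfc : ContinuousAt (fderiv ℝ h) p :=
          (hhp.1.1.fderiv_right (m := 1) (by norm_num)).continuousAt
        -- Having slope `G₀` forces this expression to vanish. It is nonzero at `p`, hence nearby.
        have hc : ContinuousAt (fun q : Heis =>
            G₀ * fderiv ℝ h q (1, 0, 0) + 1 * fderiv ℝ h q (0, 1, q.1)) p := by fun_prop
        have hne := hc.eventually_ne (y := 0) fun h0 => hns (hhp.isSlope hp (by simpa using h0))
        filter_upwards [hne, hh] with q h1 h2 _ hqA
        exact h1 (h2.fderiv_eq_zero_of_flatLine hqA.1)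
      · have hc : ContinuousAt (fun q : Heis => q.1 - G₀ * q.2.1) p := by fun_prop
        filter_upwards [hc.eventually_ne hx] with q hq _ hqA
        exact hq hqA.2
  refine ⟨fun hz => by linarith [(hsub hz).2], fun hz => ?_⟩
  refine hM.hasEndpoints.mem_of_plane hG₀.mem (fun z hz => by linarith [(hsub hz).2])
    (fun p hp => ?_) hz
  obtain ⟨φ, hφC, hφP, hφ, hφs⟩ := hM.exists_graph (hsub hp).1
  filter_upwards [hφ, continuousAt_snd.eventually hφs] with q h1 h2 hq
  -- The graph point over `q.2` lies in the plane and has the same `u` as `q`, so it is `q`.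
  have h3 := (hsub h2.mem).2
  refine h1.2 ?_
  simp only at h3
  linarith

/-! ### Surfaces whose lines are all parallel to `∂ₓ` -/

theorem IsRuledChart.fderiv_x_eq_zero {M : Set Heis} {h : Heis → ℝ} {z : Heis}
    (hh : IsRuledChart M h z) (hz : z ∈ M) (hno : ∀ G, ¬ IsSlope M z G) :
    fderiv ℝ h z (1, 0, 0) = 0 := by
  by_contra hne
  refine hno (-fderiv ℝ h z (0, 1, z.1) / fderiv ℝ h z (1, 0, 0)) (hh.isSlope hz ?_)
  field_simp
  ring

/-- If `∂ₓ` is everywhere tangent to `M`, then so is `∂ᵥ`. -/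
theorem IsRuled.fderiv_v_eq_zero {M : Set Heis} (hM : IsRuled M)
    (hno : ∀ z G, ¬ IsSlope M z G) {P : Heis} (hP : P ∈ M) {h : Heis → ℝ}
    (hh : ∀ᶠ z in 𝓝 P, IsRuledChart M h z) : fderiv ℝ h P (0, 0, 1) = 0 := by
  by_contra hne
  let e : (ℝ × ℝ) × ℝ →L[ℝ] Heis :=
    ((ContinuousLinearMap.fst ℝ ℝ ℝ).comp (ContinuousLinearMap.fst ℝ (ℝ × ℝ) ℝ)).prod
      (((ContinuousLinearMap.snd ℝ ℝ ℝ).comp (ContinuousLinearMap.fst ℝ (ℝ × ℝ) ℝ)).prod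
        (ContinuousLinearMap.snd ℝ (ℝ × ℝ) ℝ))
  have hhP := hh.self_of_nhds
  obtain ⟨φ, hφC, hφP, -, hφ⟩ := exists_implicit e (h := h) (y := ((P.1, P.2.1), P.2.2))
    hhP.1.1 (hhP.1.2.self_of_nhds.1 hP) hne
  simp only at hφC hφP hφ
  have hmk : HasDerivAt (fun u : ℝ => (P.1, u)) (0, 1) P.2.1 :=
    (hasDerivAt_const P.2.1 P.1).prodMk (hasDerivAt_id P.2.1)
  have hder : HasDerivAt (fun u : ℝ => φ (P.1, u)) (fderiv ℝ φ (P.1, P.2.1) (0, 1)) P.2.1 :=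
    HasFDerivAt.comp_hasDerivAt (l := φ) P.2.1 (hφC.differentiableAt (by simp)).hasFDerivAt hmk
  set m := fderiv ℝ φ (P.1, P.2.1) (0, 1)
  have hmem : ∀ᶠ u in 𝓝 P.2.1, ∀ x, ((x, u, φ (P.1, u)) : Heis) ∈ M := by
    have hc : ContinuousAt (fun u : ℝ => ((P.1, u, φ (P.1, u)) : Heis)) P.2.1 :=
      continuousAt_const.prodMk (continuousAt_id.prodMk hder.continuousAt)
    have hh' : ∀ᶠ z in 𝓝 ((P.1, P.2.1, φ (P.1, P.2.1)) : Heis), IsRuledChart M h z := by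
      rw [hφP]
      exact hh
    filter_upwards [hc.eventually hh', hmk.continuousAt.eventually hφ] with u h1 h2 x
    have hM' := h1.1.2.self_of_nhds.2 h2.1
    have := (h1.2 hM').2 1 0 (by rw [h1.fderiv_x_eq_zero hM' (hno _)]; simp) (x - P.1)
    simpa [flatLine] using this
  -- The tangent vector `(0, 1, m)` is the same all along the line parallel to `∂ₓ`; at `x = m` it
  -- equals `∂ᵤ + x ∂ᵥ`, which makes that point characteristic.
  have hQ : ((m, P.2.1, φ (P.1, P.2.1)) : Heis) ∈ M := hmem.self_of_nhds m
  obtain ⟨k, hk⟩ := hM.exists_chart _ hQ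
  have hkQ := hk.self_of_nhds
  have htan := hkQ.1.fderiv_apply_eq_zero (c := fun u => (m, u, φ (P.1, u)))
    ((hasDerivAt_const P.2.1 m).prodMk ((hasDerivAt_id P.2.1).prodMk hder))
    ((hmem.mono fun u hu => hu m).filter_mono nhdsWithin_le_nhds).frequently
  exact (hkQ.2 hQ).1 ⟨hkQ.fderiv_x_eq_zero hQ (hno _), htan⟩

/-- Both `∂ₓ` and `∂ᵥ` are tangent, so `M` is locally a graph `u = φ (x, v)` with `dφ = 0`. -/
theorem IsRuled.eventually_mem_iff_of_not_isSlope {M : Set Heis} (hM : IsRuled M)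
    (hno : ∀ z G, ¬ IsSlope M z G) {P : Heis} (hP : P ∈ M) :
    ∀ᶠ z in 𝓝 P, z ∈ M ↔ z.2.1 = P.2.1 := by
  obtain ⟨h, hh⟩ := hM.exists_chart P hP
  let e : (ℝ × ℝ) × ℝ →L[ℝ] Heis :=
    ((ContinuousLinearMap.fst ℝ ℝ ℝ).comp (ContinuousLinearMap.fst ℝ (ℝ × ℝ) ℝ)).prod
      ((ContinuousLinearMap.snd ℝ (ℝ × ℝ) ℝ).prod
        ((ContinuousLinearMap.snd ℝ ℝ ℝ).comp (ContinuousLinearMap.fst ℝ (ℝ × ℝ) ℝ)))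
  have hgrad : ∀ᶠ z in 𝓝 P, z ∈ M → fderiv ℝ h z (1, 0, 0) = 0 ∧ fderiv ℝ h z (0, 0, 1) = 0 ∧
      fderiv ℝ h z (0, 1, 0) ≠ 0 := by
    filter_upwards [hh.eventually_nhds] with z hz hzM
    have hzz := hz.self_of_nhds
    have hx := hzz.fderiv_x_eq_zero hzM (hno z)
    have hv := hM.fderiv_v_eq_zero hno hzM hz
    refine ⟨hx, hv, fun hu => (hzz.2 hzM).1 ⟨hx, ?_⟩⟩
    have hdec : ((0, 1, z.1) : Heis) = (0, 1, 0) + z.1 • (0, 0, 1) := by ext <;> simp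
    rw [hdec, map_add, map_smul, hu, hv]
    simp
  have hhP := hh.self_of_nhds
  obtain ⟨φ, hφC, hφP, hφiff, hφ⟩ := exists_implicit e (h := h) (y := ((P.1, P.2.2), P.2.1))
    hhP.1.1 (hhP.1.2.self_of_nhds.1 hP) (hgrad.self_of_nhds hP).2.2
  simp only at hφC hφP hφ
  have hconst : ∀ᶠ w in 𝓝 (P.1, P.2.2), φ w = φ (P.1, P.2.2) := by
    refine eventually_eq_of_fderiv_eq_zero ?_
    have hc : ContinuousAt (fun w => e (w, φ w)) (P.1, P.2.2) :=
      e.continuous.continuousAt.comp (continuousAt_id.prodMk hφC.continuousAt)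
    have hlim : ∀ᶠ z in 𝓝 (e ((P.1, P.2.2), φ (P.1, P.2.2))), IsRuledChart M h z ∧
        (z ∈ M → fderiv ℝ h z (1, 0, 0) = 0 ∧ fderiv ℝ h z (0, 0, 1) = 0 ∧
          fderiv ℝ h z (0, 1, 0) ≠ 0) := by
      rw [hφP]
      exact hh.and hgrad
    filter_upwards [hφC.eventually (by simp), hc.eventually hlim, hφ] with w h1 ⟨h2, h3⟩ ⟨h4, h5⟩
    refine ⟨h1.differentiableAt (by simp), ContinuousLinearMap.ext fun k => ?_⟩
    obtain ⟨hx, hv, hu⟩ := h3 (h2.1.2.self_of_nhds.2 h4)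
    have h6 := h5 k
    have hdec : e (k, fderiv ℝ φ w k) = k.1 • ((1, 0, 0) : Heis) +
        (fderiv ℝ φ w k • (0, 1, 0) + k.2 • (0, 0, 1)) := by
      ext <;> simp [e]
    rw [hdec, map_add, map_add, map_smul, map_smul, map_smul, hx, hv] at h6
    simpa [hu] using h6
  have ht1 : Tendsto (fun z : Heis => ((z.1, z.2.2), z.2.1)) (𝓝 P)
      (𝓝 ((P.1, P.2.2), P.2.1)) := Continuous.tendsto (by fun_prop) P
  have ht2 : Tendsto (fun z : Heis => (z.1, z.2.2)) (𝓝 P) (𝓝 (P.1, P.2.2)) :=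
    Continuous.tendsto (by fun_prop) P
  filter_upwards [hhP.1.2, ht1.eventually hφiff, ht2.eventually hconst] with z h1 h2 h3
  rw [h1]
  refine h2.trans ?_
  rw [h3, hφP]
  exact eq_comm

theorem IsRuled.eq_plane_of_not_isSlope {M : Set Heis} (hM : IsRuled M)
    (hconn : IsPreconnected M) (hno : ∀ z G, ¬ IsSlope M z G) {P : Heis} (hP : P ∈ M) (z : Heis) :
    z ∈ M ↔ 0 * z.1 + 1 * z.2.1 = P.2.1 := by
  have hsub : M ⊆ {p | p.2.1 = P.2.1} := by
    refine subset_of_isPreconnected hconn (fun p hp hpA => ?_) (fun p hp hpA => ?_) ⟨P, hP, rfl⟩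
    · filter_upwards [hM.eventually_mem_iff_of_not_isSlope hno hp] with q hq hqM
      exact (hq.1 hqM).trans hpA
    · filter_upwards [hM.eventually_mem_iff_of_not_isSlope hno hp] with q hq hqM hqA
      exact hpA ((hq.1 hqM).symm.trans hqA)
  have hsub' : ∀ z ∈ M, 0 * z.1 + 1 * z.2.1 = P.2.1 := fun z hz => by
    have : z.2.1 = P.2.1 := hsub hz
    linarith
  refine ⟨hsub' z, fun hz => hM.hasEndpoints.mem_of_plane hP hsub' (fun p hp => ?_) hz⟩
  filter_upwards [hM.eventually_mem_iff_of_not_isSlope hno hp] with q hq hqP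
  have : p.2.1 = P.2.1 := hsub hp
  exact hq.2 (by linarith)

theorem isVerticalPlane_of_preimage {S : Set Heis} {a b γ : ℝ} (hab : a ≠ 0 ∨ b ≠ 0)
    (h : ∀ z, z ∈ ofFlat ⁻¹' S ↔ a * z.1 + b * z.2.1 = γ) : IsVerticalPlane S := by
  refine ⟨a, b, γ, hab, ?_⟩
  ext g
  have := h (toFlat g)
  rwa [mem_preimage, ofFlat_toFlat] at this

end Heisenberg

theorem theoremB (S : Set Heisenberg.Heis)
    (hsurf : Heisenberg.IsC2Surface S)
    (hconn : IsConnected S)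
    (hcomplete : Heisenberg.IsCompleteSurface S)
    (hnoncompact : ¬ IsCompact S)
    (hchar : Heisenberg.charLocus S = ∅)
    (hmin : Heisenberg.IsHMinimal S)
    (hplane : ¬ Heisenberg.IsVerticalPlane S) :
    ∃ (ε : ℝ) (S₀ : Set Heisenberg.Heis),
      Heisenberg.IsStrictIntrinsicGraphicalStrip ε S₀ ∧ S₀ ⊆ S := by
  open Heisenberg in
  have hM := isRuled_preimage hsurf hcomplete hchar hmin
  have hpre : IsPreconnected (ofFlat ⁻¹' S) := by
    have himage : toFlat '' S = ofFlat ⁻¹' S :=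
      congrFun (image_eq_preimage_of_inverse ofFlat_toFlat toFlat_ofFlat) S
    rw [← himage]
    exact hconn.isPreconnected.image _ (contDiff_toFlat (n := 1)).continuous.continuousOn
  obtain ⟨g, hg⟩ := hconn.nonempty
  by_contra hstrip
  have hflat : ∀ (F G : ℝ → ℝ) (s : ℝ), ContDiffAt ℝ 2 F s → ContDiffAt ℝ 2 G s →
      (∀ᶠ r in 𝓝 s, IsSlope (ofFlat ⁻¹' S) (F r, 0, r) (G r)) →
      ¬ deriv F s ^ 2 < 2 * deriv G s :=
    fun F G s hF hG hs hlt => hstrip (exists_strip hF hG hlt hs)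
  -- One line transverse to `∂ₓ` suffices for a plane `x - G₀ y = const`; with none the plane is `y
  -- = const`.
  by_cases hno : ∃ z G, IsSlope (ofFlat ⁻¹' S) z G
  · obtain ⟨P, G₀, hG₀⟩ := hno
    exact hplane (isVerticalPlane_of_preimage (Or.inl one_ne_zero)
      (hM.eq_plane_of_isSlope hpre hflat hG₀))
  · push Not at hno
    have hgM : toFlat g ∈ ofFlat ⁻¹' S := by simpa using hg
    exact hplane (isVerticalPlane_of_preimage (Or.inr one_ne_zero)
      (hM.eq_plane_of_not_isSlope hpre hno hgM))
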